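/- Consider a gossip network: a countable directed graph in which every node has finitely many in-neighbours, with a distinguished source node $n_0$ that has no incoming edges, and with a rate $\lambda_{uv}>0$ for each edge $(u,v)$. The edges carry mutually independent Poisson clocks of these rates. Each node $v$ stores a timestamp $N_v(t)$: the source has $N_{n_0}(t)=t$, all other nodes start with $N_v(0)=0$, and when the clock $(u,v)$ rings at time $t$, $N_v$ is updated to $\max\{N_v(t^-),N_u(t^-)\}$; between the rings of clocks into $v$, $N_v$ is constant. (On an infinite graph $N$ is the least solution of these rules, i.e. timestamps reach a node only along finitely many rings from the source.) The age of information of a set $S$ of nodes at time $t$ is $X_S(t)=\inf_{v\in S}(t-N_v(t))$ (a minimum if $S$ is finite). For a set $S$ of nodes with $n_0\notin S$, let $E(S)$ be the set of edges $(u,v)$ with $u\notin S$, $u\ne n_0$, $v\in S$, let $\lambda_0(S)=\sum_{v\in S}\lambda_{n_0v}$ (with $\lambda_{n_0 v}=0$ if $(n_0,v)$ is not an edge), and for $e=(u,v)$ let $S\cup e=S\cup\{u,v\}$. Assume that the total rate $\lambda_0(S)+\sum_{e\in E(S)}\lambda_e$ into $S$ is finite (automatic for finite $S$) and that some node of $S$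 can be reached from $n_0$ by a directed path. Then the age of $S$ has a time-invariant law for large $t$: there is a real random variable $X_S$ with $$\mathbb P[X_S(t)\le x]=\mathbb P[X_S\le x]\qquad\text{for every real } x \text{ and all } t\ge 0 \text{ with } t>x .$$ Its mean is finite, $\mathbb E[X_S(t)]\to\mathbb E[X_S]$ as $t\to\infty$, the total rate into $S$ is positive, and $$\mathbb E[X_S]=\frac{1+\sum_{e\in E(S)}\lambda_e\,\mathbb E[X_{S\cup e}]}{\lambda_0(S)+\sum_{e\in E(S)}\lambda_e},$$ where the sum in the numerator converges and each $S\cup e$ satisfies the same assumptions as $S$. -/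

import Mathlib

open MeasureTheory ProbabilityTheory Filter Topology Set
open scoped NNReal ENNReal

/-- A locally finite gossip network on a vertex set `V`: a distinguished source that receives
nothing, and a rate `rate u v` for each ordered pair; `(u, v)` is a directed edge exactly if
`rate u v ≠ 0`. Every vertex has finitely many in-neighbours. -/
structure GossipNetwork (V : Type*) where
  source : V
  rate : V → V → ℝ≥0
  rate_source : ∀ u, rate u source = 0
  finite_in : ∀ v, {u | rate u v ≠ 0}.Finite

/-- The number of points of `A` in the time interval `(0, t]`. -/
noncomputable def ringCount (A : Set ℝ≥0) (t : ℝ≥0) : ℕ := (A ∩ Ioc 0 t).ncard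

/-- `A ω` is the random set of ring times of a Poisson clock of rate `r`: it is locally finite, and
the number of rings up to time `t` is a process with independent Poisson increments. -/
structure IsPoissonClock {Ω : Type*} [MeasurableSpace Ω] (r : ℝ≥0) (A : Ω → Set ℝ≥0)
    (P : Measure Ω) : Prop where
  pos : ∀ ω, ∀ t ∈ A ω, 0 < t
  locallyFinite : ∀ ω t, (A ω ∩ Iic t).Finite
  measurable : ∀ t, Measurable fun ω => ringCount (A ω) t
  law : ∀ s t, s ≤ t →
    HasLaw (fun ω => ringCount (A ω) t - ringCount (A ω) s) (poissonMeasure (r * (t - s))) P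
  indep : HasIndepIncrements (fun t ω => ringCount (A ω) t) P

namespace GossipNetwork

variable {V : Type*}

/-- The clocks of the network: `R u v` is a Poisson clock of rate `rate u v`, and the clocks (as
counting processes) are mutually independent. -/
structure IsClocks (G : GossipNetwork V) {Ω : Type*} [MeasurableSpace Ω]
    (R : V → V → Ω → Set ℝ≥0) (P : Measure Ω) : Prop where
  poisson : ∀ u v, IsPoissonClock (G.rate u v) (R u v) P
  indep : iIndepFun (fun (e : V × V) ω (t : ℝ≥0) => ringCount (R e.1 e.2 ω) t) P

/-- `N v t` is the timestamp stored by `v` at time `t`. It obeys the rules of gossip driven by the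
ring times `ring u v`: the source stores the current time, all other nodes start with timestamp `0`,
a node keeps its timestamp as long as no clock into it rings, and when the clock `(u, v)` rings at
time `t`, `v` gets the larger one of the timestamps that `u` and `v` have immediately before `t`. -/
structure ObeysGossip (G : GossipNetwork V) (ring : V → V → Set ℝ≥0) (N : V → ℝ≥0 → ℝ) :
    Prop where
  source : ∀ t, N G.source t = t
  init : ∀ v, N v 0 = 0
  keep : ∀ v, v ≠ G.source → ∀ s t, s ≤ t → (∀ u, ∀ r ∈ ring u v, r ∉ Ioc s t) → N v t = N v s
  update : ∀ u v, ∀ t ∈ ring u v,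
    Tendsto (fun s => max (N v s) (N u s)) (𝓝[<] t) (𝓝 (N v t))

/-- The timestamps of the gossip network: the pointwise least solution of the gossip rules. For
finitely many nodes the rules determine `N` for almost every realisation of the clocks, and
leastness is automatic. On an infinite network it says that a node stores only timestamps which
reached it from the source along finitely many rings, and none that come "from infinity". -/
def IsTimestamps (G : GossipNetwork V) (ring : V → V → Set ℝ≥0) (N : V → ℝ≥0 → ℝ) : Prop :=
  IsLeast {N' | G.ObeysGossip ring N'} N

/-- The age of information of the set `S` at time `t`: the smallest age `t - N v t` of a node
`v ∈ S`. -/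
noncomputable def age (N : V → ℝ≥0 → ℝ) (S : Set V) (t : ℝ≥0) : ℝ := ⨅ v : S, ((t : ℝ) - N v t)

/-- `E(S)`: the edges from outside `S` into `S`, except those that start at the source. -/
def inBoundary (G : GossipNetwork V) (S : Set V) : Set (V × V) :=
  {e | G.rate e.1 e.2 ≠ 0 ∧ e.1 ∉ S ∧ e.2 ∈ S ∧ e.1 ≠ G.source}

/-- `λ₀(S)`: the total rate from the source into `S`. -/
noncomputable def sourceRate (G : GossipNetwork V) (S : Set V) : ℝ :=
  ∑' v : S, (G.rate G.source v : ℝ)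

/-- The total rate into `S` is finite (automatic if `S` is finite or has finitely many in-edges). -/
def FiniteRate (G : GossipNetwork V) (S : Set V) : Prop :=
  (Summable fun v : S => (G.rate G.source v : ℝ)) ∧
    Summable fun e : G.inBoundary S => (G.rate e.1.1 e.1.2 : ℝ)

/-- Some node of `S` is the end of a directed path from the source. -/
def Reachable (G : GossipNetwork V) (S : Set V) : Prop :=
  ∃ v ∈ S, Relation.ReflTransGen (fun a b => G.rate a b ≠ 0) G.source v

end GossipNetwork

/-! The age of `S` at time `s + x` is below `x` exactly when a state that the source had at some
time `≥ s` has reached `S` by time `s + x` through finitely many rings (`age_latest_lt_iff`). The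
clocks are stationary, so the probability `F_S(x)` of this event does not depend on `s`. `F_S` is
the distribution function of the limit law, and the mean age at time `t` is `M_S(t) = ∫₀ᵗ (1 -
F_S)`.

Extend the window by a final piece of length `h`. Up to probability `o(h)`, at most one relevant
clock rings in it; if that clock is `e = (u, v)`, entering `S`, then `S` is informed at the end iff
`S ∪ e` was informed before. Hence `F_S` has the right derivative `∑ λ_e (F_{S ∪ e} - F_S)` over all
edges entering `S`, with `F_{S ∪ e} = 1` for edges from the source (`hasDerivWithinAt_reachProb`).

Integration gives `F_S(t) - F_S(0) = ∑ λ_e (M_S(t) - M_{S ∪ e}(t))` (`hasSum_truncMean`). Keeping a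
single term and moving along a path from the source bounds `M_S` (`exists_truncMean_le`). As `t → ∞`
the identity becomes `1 = ∑ λ_e (m_S - m_{S ∪ e})` (`hasSum_limitMean`), which is the recursion,
since `m_{S ∪ e} = 0` for source edges.

Measurability, stationarity and independence come from cutting time into small cells and allowing
one hop per cell (`spread`): such events depend only on independent Poisson counts. -/

/-! ### Counts of rings, and convergence of measures. -/

lemma ringCount_sub_ringCount {A : Set ℝ≥0} (hA : ∀ t, (A ∩ Iic t).Finite) {a b : ℝ≥0}
    (hab : a ≤ b) : ringCount A b - ringCount A a = (A ∩ Ioc a b).ncard := by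
  have hfin : ∀ c d, (A ∩ Ioc c d).Finite := fun c d =>
    (hA d).subset fun r hr => ⟨hr.1, hr.2.2⟩
  have : A ∩ Ioc 0 b = A ∩ Ioc 0 a ∪ A ∩ Ioc a b := by
    rw [← inter_union_distrib_left, Ioc_union_Ioc_eq_Ioc zero_le hab]
  rw [ringCount, ringCount, this, ncard_union_eq _ (hfin _ _) (hfin _ _), Nat.add_sub_cancel_left]
  exact Set.disjoint_left.2 fun r hr hr' => absurd hr.2.2 (not_le.2 hr'.2.1)

lemma ringCount_sub_ne_zero_iff {A : Set ℝ≥0} (hA : ∀ t, (A ∩ Iic t).Finite) {a b : ℝ≥0}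
    (hab : a ≤ b) : ringCount A b - ringCount A a ≠ 0 ↔ ∃ r ∈ A, r ∈ Ioc a b := by
  rw [ringCount_sub_ringCount hA hab, ← Nat.pos_iff_ne_zero,
    ncard_pos ((hA b).subset fun r hr => ⟨hr.1, hr.2.2⟩)]
  rfl

lemma poissonMeasure_ne_zero (r : ℝ≥0) :
    poissonMeasure r {n | n ≠ 0} = ENNReal.ofReal (1 - Real.exp (-r)) := by
  have : {n : ℕ | n ≠ 0} = {0}ᶜ := rfl
  rw [this, prob_compl_eq_one_sub (measurableSet_singleton 0), poissonMeasure_singleton,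
    ENNReal.ofReal_sub _ (Real.exp_pos _).le]
  simp

/-- Grids with `n + 1` cells are not nested, so the approximating events need not increase with `n`;
pointwise convergence of indicators replaces continuity from below. -/
lemma tendsto_measure_inter_of_eventually_mem {Ω : Type*} [MeasurableSpace Ω] (P : Measure Ω)
    [IsFiniteMeasure P] {A : ℕ → Set Ω} {B E : Set Ω} (hA : ∀ n, MeasurableSet (A n))
    (hAB : ∀ n, A n ⊆ B) (h : ∀ ω ∈ B, ∀ᶠ n in atTop, ω ∈ A n) (hE : MeasurableSet E) :
    Tendsto (fun n => P (A n ∩ E)) atTop (𝓝 (P (B ∩ E))) := by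
  have hB : B = ⋃ n, A n := by
    refine subset_antisymm (fun ω hω => ?_) (iUnion_subset hAB)
    obtain ⟨n, hn⟩ := (h ω hω).exists
    exact mem_iUnion.2 ⟨n, hn⟩
  refine tendsto_measure_of_tendsto_indicator_of_isFiniteMeasure atTop P
    (fun n => (hA n).inter hE) (fun ω => ?_)
  by_cases hω : ω ∈ B
  · filter_upwards [h ω hω] with n hn
    simp [hn, hω]
  · refine Eventually.of_forall fun n => ?_
    simp [hω, show ω ∉ A n from fun h => hω (hAB n h)]

namespace GossipNetwork

variable {V : Type*}

/-! ### Timestamps for a fixed realisation of the clocks. -/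

/-- `Informed ring n₀ s v t`: the state of the source `n₀` at some time `≥ s` has reached `v` by
time `t`, along finitely many successive rings. -/
inductive Informed (ring : V → V → Set ℝ≥0) (n₀ : V) (s : ℝ≥0) : V → ℝ≥0 → Prop
  | source {t : ℝ≥0} : s ≤ t → Informed ring n₀ s n₀ t
  | step {u v : V} {r r' t : ℝ≥0} : Informed ring n₀ s u r → r < r' → r' ∈ ring u v → r' ≤ t →
      Informed ring n₀ s v t

section Deterministic

variable {ring : V → V → Set ℝ≥0} {n₀ : V} {s t : ℝ≥0} {v : V}

lemma Informed.mono (h : Informed ring n₀ s v t) {t' : ℝ≥0} (ht : t ≤ t') :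
    Informed ring n₀ s v t' := by
  cases h with
  | source h => exact .source (h.trans ht)
  | step h1 h2 h3 h4 => exact .step h1 h2 h3 (h4.trans ht)

lemma Informed.anti (h : Informed ring n₀ s v t) {s' : ℝ≥0} (hs : s' ≤ s) :
    Informed ring n₀ s' v t := by
  induction h with
  | source h => exact .source (hs.trans h)
  | step h1 h2 h3 h4 ih => exact .step ih h2 h3 h4

lemma Informed.le (h : Informed ring n₀ s v t) : s ≤ t := by
  induction h with
  | source h => exact h
  | step h1 h2 h3 h4 ih => exact ih.trans (h2.le.trans h4)

/-- The hop out of the source occurs strictly after the time by which the source is required to have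
its state, so a slightly later state makes the same journey. -/
lemma Informed.exists_gt (h : Informed ring n₀ s v t) (hv : v ≠ n₀) :
    ∃ s' > s, Informed ring n₀ s' v t := by
  induction h with
  | source h => exact absurd rfl hv
  | @step u v r r' t h1 h2 h3 h4 ih =>
    by_cases hu : u = n₀
    · subst hu
      obtain ⟨m, hm, hm'⟩ := exists_between h2
      exact ⟨m, h1.le.trans_lt hm, .step (.source le_rfl) hm' h3 h4⟩
    · obtain ⟨s', hs', h⟩ := ih hu
      exact ⟨s', hs', .step h h2 h3 h4⟩

/-- The latest timestamp that has reached `v` by time `t`. -/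
noncomputable def latest (ring : V → V → Set ℝ≥0) (n₀ v : V) (t : ℝ≥0) : ℝ≥0 :=
  sSup {s | Informed ring n₀ s v t}

lemma bddAbove_informed : BddAbove {s | Informed ring n₀ s v t} := ⟨t, fun _ h => h.le⟩

lemma Informed.le_latest (h : Informed ring n₀ s v t) : s ≤ latest ring n₀ v t :=
  le_csSup bddAbove_informed h

/-- In `ℝ≥0` the supremum of the empty set is `0`, which is the right timestamp for a node not yet
reached; no nonemptiness is needed. -/
lemma latest_le_of_forall {b : ℝ≥0} (h : ∀ s, Informed ring n₀ s v t → s ≤ b) :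
    latest ring n₀ v t ≤ b := csSup_le' h

lemma latest_le : latest ring n₀ v t ≤ t := latest_le_of_forall fun _ h => h.le

lemma lt_latest_iff : s < latest ring n₀ v t ↔ ∃ s' > s, Informed ring n₀ s' v t := by
  constructor
  · intro h
    by_contra! hc
    exact absurd h (not_lt.2 (latest_le_of_forall fun s' h' =>
      not_lt.1 fun hs => hc s' hs h'))
  · rintro ⟨s', hs, h⟩
    exact hs.trans_le h.le_latest

lemma latest_mono : Monotone (latest ring n₀ v) := fun _ _ h =>
  latest_le_of_forall fun _ h' => (h'.mono h).le_latest

/-- Realisations of the clocks that occur almost surely. -/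
structure IsRegular (G : GossipNetwork V) (ring : V → V → Set ℝ≥0) : Prop where
  finite : ∀ u v t, (ring u v ∩ Iic t).Finite
  empty : ∀ u v, G.rate u v = 0 → ring u v = ∅
  disjoint : ∀ u u' v, u ≠ u' → Disjoint (ring u v) (ring u' v)

variable {G : GossipNetwork V}

lemma IsRegular.obeysGossip_latest (h : G.IsRegular ring) :
    G.ObeysGossip ring fun v t => (latest ring G.source v t : ℝ) where
  source t := by
    have : latest ring G.source G.source t = t :=
      le_antisymm latest_le (Informed.source le_rfl).le_latest
    exact_mod_cast this
  init v := by
    have : latest ring G.source v 0 = 0 := le_antisymm latest_le zero_le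
    exact_mod_cast this
  keep v hv s t hst hr := by
    have : latest ring G.source v t = latest ring G.source v s := by
      refine le_antisymm (latest_le_of_forall fun s' hs' => ?_) (latest_mono hst)
      cases hs' with
      | source => exact absurd rfl hv
      | @step u _ r r' _ h1 h2 h3 h4 =>
        have : r' ≤ s := by
          by_contra! hc
          exact hr u r' h3 ⟨hc, h4⟩
        exact (Informed.step h1 h2 h3 this).le_latest
    exact_mod_cast this
  update u v t ht := by
    have hv : v ≠ G.source := by
      rintro rfl
      rw [h.empty u _ (G.rate_source u)] at ht
      exact ht
    have : Tendsto (fun s => max (latest ring G.source v s) (latest ring G.source u s)) (𝓝[<] t)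
        (𝓝 (latest ring G.source v t)) := by
      refine tendsto_order.2 ⟨fun a ha => ?_, fun a ha => ?_⟩
      · obtain ⟨s', hs', hi⟩ := lt_latest_iff.1 ha
        cases hi with
        | source => exact absurd rfl hv
        | @step u' _ r r' _ h1 h2 h3 h4 =>
          -- If the last hop precedes `t`, the state is at `v` before `t`. If it is the ring at `t`
          -- itself, disjointness of the clocks into `v` shows that it came from `u`, where it was
          -- present from `r < t` on.
          rcases h4.lt_or_eq with h4 | rfl
          · filter_upwards [Ioo_mem_nhdsLT h4] with q hq
            exact lt_max_of_lt_left (lt_latest_iff.2 ⟨s', hs', .step h1 h2 h3 hq.1.le⟩)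
          · have : u' = u := by
              by_contra hne
              exact (Set.disjoint_left.1 (h.disjoint u' u v hne) h3) ht
            subst this
            filter_upwards [Ioo_mem_nhdsLT h2] with q hq
            exact lt_max_of_lt_right (lt_latest_iff.2 ⟨s', hs', h1.mono hq.1.le⟩)
      · filter_upwards [self_mem_nhdsWithin] with q hq
        refine lt_of_le_of_lt (max_le (latest_mono (le_of_lt hq)) ?_) ha
        exact latest_le_of_forall fun s' hs' => (Informed.step hs' hq ht le_rfl).le_latest
    have := (NNReal.continuous_coe.tendsto _).comp this
    refine this.congr fun s => ?_
    simp

lemma IsRegular.finite_rings_into (h : G.IsRegular ring) (v : V) (a b : ℝ≥0) :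
    {r | r ∈ Ioc a b ∧ ∃ u, r ∈ ring u v}.Finite := by
  refine ((G.finite_in v).biUnion fun u _ => h.finite u v b).subset ?_
  rintro r ⟨hr, u, hu⟩
  refine mem_iUnion₂.2 ⟨u, fun h0 => ?_, hu, hr.2⟩
  rw [h.empty u v h0] at hu
  exact hu

/-- Induction on the number of rings into `v` in `(a, b]`. After the last ring `m` nothing changes,
and `N v m` is a limit of maxima that are at least `N v q` with `q < m`, where `(a, q]` contains
fewer rings. -/
lemma IsRegular.monotone_of_obeysGossip (h : G.IsRegular ring) {N : V → ℝ≥0 → ℝ}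
    (hN : G.ObeysGossip ring N) (v : V) : Monotone (N v) := by
  by_cases hv : v = G.source
  · subst hv
    intro a b hab
    simpa [hN.source] using hab
  suffices H : ∀ n a b, a ≤ b → {r | r ∈ Ioc a b ∧ ∃ u, r ∈ ring u v}.ncard = n → N v a ≤ N v b from
    fun a b hab => H _ a b hab rfl
  intro n
  induction n using Nat.strong_induction_on with
  | _ n ih =>
  intro a b hab hn
  rcases Set.eq_empty_or_nonempty {r | r ∈ Ioc a b ∧ ∃ u, r ∈ ring u v} with he | hne
  · refine (hN.keep v hv a b hab fun u r hr hr' => ?_).ge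
    exact (Set.eq_empty_iff_forall_notMem.1 he) r ⟨hr', u, hr⟩
  · obtain ⟨m, ⟨hm, u, hu⟩, hmax⟩ := (h.finite_rings_into v a b).exists_maximal hne
    have h1 : N v b = N v m := by
      refine hN.keep v hv m b hm.2 fun u' r hr hr' => ?_
      exact absurd (hmax ⟨⟨hm.1.trans hr'.1, hr'.2⟩, u', hr⟩ hr'.1.le) (not_le.2 hr'.1)
    rw [h1]
    have : (𝓝[<] m).NeBot := nhdsLT_neBot_of_exists_lt ⟨a, hm.1⟩
    refine ge_of_tendsto (hN.update u v m hu) ?_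
    filter_upwards [Ioo_mem_nhdsLT hm.1] with q hq
    refine le_max_of_le_left (ih _ ?_ a q hq.1.le rfl)
    rw [← hn]
    refine Set.ncard_lt_ncard ⟨?_, ?_⟩ (h.finite_rings_into v a b)
    · rintro r ⟨hr, hr'⟩
      exact ⟨⟨hr.1, hr.2.trans (hq.2.le.trans hm.2)⟩, hr'⟩
    · intro hc
      exact absurd (hc ⟨hm, u, hu⟩).1.2 (not_le.2 hq.2)

lemma IsRegular.le_of_informed (h : G.IsRegular ring) {N : V → ℝ≥0 → ℝ}
    (hN : G.ObeysGossip ring N) (hi : Informed ring G.source s v t) : (s : ℝ) ≤ N v t := by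
  induction hi with
  | source h => rw [hN.source]; exact_mod_cast h
  | @step u v r r' t h1 h2 h3 h4 ih =>
    refine le_trans ?_ (h.monotone_of_obeysGossip hN v h4)
    have : (𝓝[<] r').NeBot := nhdsLT_neBot_of_exists_lt ⟨r, h2⟩
    refine ge_of_tendsto (hN.update u v r' h3) ?_
    filter_upwards [Ioo_mem_nhdsLT h2] with q hq
    exact le_max_of_le_right (ih.trans (h.monotone_of_obeysGossip hN u hq.1.le))

/-- `latest` is itself a solution, so the least solution is below it; by `le_of_informed` every
solution is above it. -/
lemma IsRegular.eq_latest (h : G.IsRegular ring) {N : V → ℝ≥0 → ℝ}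
    (hN : G.IsTimestamps ring N) : N = fun v t => (latest ring G.source v t : ℝ) := by
  refine le_antisymm (hN.2 h.obeysGossip_latest) fun v t => ?_
  have h0 : 0 ≤ N v t := (hN.1.init v).ge.trans (h.monotone_of_obeysGossip hN.1 v zero_le)
  have : latest ring G.source v t ≤ (⟨N v t, h0⟩ : ℝ≥0) :=
    latest_le_of_forall fun s hs => h.le_of_informed hN.1 hs
  exact this

lemma age_latest_nonneg (S : Set V) (t : ℝ≥0) :
    0 ≤ age (fun v t => (latest ring n₀ v t : ℝ)) S t :=
  Real.iInf_nonneg fun _ => sub_nonneg.2 (NNReal.coe_le_coe.2 latest_le)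

lemma bddBelow_age_latest (S : Set V) (t : ℝ≥0) :
    BddBelow (range fun v : S => (t : ℝ) - latest ring n₀ v t) :=
  ⟨0, by rintro _ ⟨v, rfl⟩; exact sub_nonneg.2 (NNReal.coe_le_coe.2 latest_le)⟩

lemma age_latest_le {S : Set V} (t : ℝ≥0) :
    age (fun v t => (latest ring n₀ v t : ℝ)) S t ≤ t := by
  rcases S.eq_empty_or_nonempty with rfl | ⟨v, hv⟩
  · simp [age]
  · refine (ciInf_le (bddBelow_age_latest S t) ⟨v, hv⟩).trans ?_
    simp

/-- The strict inequality makes this exact even for infinite `S`: an infimum is below `x` iff some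
term is. `exists_gt` then trades states later than `s` for states at times `≥ s`. -/
lemma age_latest_lt_iff {S : Set V} (hS : S.Nonempty) (hn : n₀ ∉ S) (s x : ℝ≥0) :
    age (fun v t => (latest ring n₀ v t : ℝ)) S (s + x) < x ↔
      ∃ v ∈ S, Informed ring n₀ s v (s + x) := by
  have := hS.to_subtype
  rw [age, ciInf_lt_iff (bddBelow_age_latest S _)]
  have key : ∀ v, ((s + x : ℝ≥0) : ℝ) - latest ring n₀ v (s + x) < x ↔
      s < latest ring n₀ v (s + x) := by
    intro v
    rw [← NNReal.coe_lt_coe]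
    push_cast
    constructor <;> intro h <;> linarith
  simp only [key, lt_latest_iff, Subtype.exists, exists_prop]
  refine exists_congr fun v => and_congr_right fun hv => ⟨?_, fun h => ?_⟩
  · rintro ⟨s', hs, h⟩
    exact h.anti (le_of_lt hs)
  · exact h.exists_gt fun e => hn (e ▸ hv)

end Deterministic

/-! ### Discretisation of time. -/

/-- The nodes reached within `i` rounds, if the edge `e` is open in round `i` when
`Y (e, i) ≠ 0`. -/
def spread (n₀ : V) (Y : (V × V) × ℕ → ℕ) : ℕ → Set V
  | 0 => {n₀}
  | i + 1 => spread n₀ Y i ∪ {v | ∃ u ∈ spread n₀ Y i, Y ((u, v), i) ≠ 0}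

lemma spread_mono (n₀ : V) (Y : (V × V) × ℕ → ℕ) : Monotone (spread n₀ Y) :=
  monotone_nat_of_le_succ fun _ => subset_union_left

/-- The σ-algebra is a parameter and only rounds `j < i` enter, so the lemma also shows
measurability with respect to the cells before a given one. -/
lemma measurableSet_mem_spread [Countable V] {Ω : Type*} (m : MeasurableSpace Ω) (n₀ : V)
    {Y : Ω → (V × V) × ℕ → ℕ} (i : ℕ) (hY : ∀ e, ∀ j < i, Measurable[m] fun ω => Y ω (e, j))
    (v : V) : MeasurableSet[m] {ω | v ∈ spread n₀ (Y ω) i} := by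
  induction i generalizing v with
  | zero => exact MeasurableSet.const _
  | succ i ih =>
    have ih' := ih fun e j hj => hY e j (hj.trans i.lt_succ_self)
    have : {ω | v ∈ spread n₀ (Y ω) (i + 1)} = {ω | v ∈ spread n₀ (Y ω) i} ∪
        ⋃ u, ({ω | u ∈ spread n₀ (Y ω) i} ∩ (fun ω => Y ω ((u, v), i)) ⁻¹' {n | n ≠ 0}) := by
      ext ω
      simp [spread]
    rw [this]
    exact (ih' v).union (MeasurableSet.iUnion fun u => (ih' u).inter
      (hY (u, v) i i.lt_succ_self (.of_discrete)))

lemma measurableSet_exists_mem_spread [Countable V] {Ω : Type*} (m : MeasurableSpace Ω) (n₀ : V)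
    {Y : Ω → (V × V) × ℕ → ℕ} (i : ℕ) (hY : ∀ e, ∀ j < i, Measurable[m] fun ω => Y ω (e, j))
    (S : Set V) : MeasurableSet[m] {ω | ∃ v ∈ S, v ∈ spread n₀ (Y ω) i} := by
  have : {ω | ∃ v ∈ S, v ∈ spread n₀ (Y ω) i} = ⋃ v ∈ S, {ω | v ∈ spread n₀ (Y ω) i} := by
    ext ω
    simp
  rw [this]
  exact MeasurableSet.biUnion S.to_countable fun v _ => measurableSet_mem_spread m n₀ i hY v

/-- The interval `(s, s + x]` divided into `n + 1` equal cells, followed by a cell of length `h`. -/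
noncomputable def grid (s x h : ℝ≥0) (n i : ℕ) : ℝ≥0 :=
  if i ≤ n + 1 then s + i * (x / (n + 1)) else s + x + h

lemma grid_zero (s x h : ℝ≥0) (n : ℕ) : grid s x h n 0 = s := by simp [grid]

lemma grid_last (s x h : ℝ≥0) (n : ℕ) : grid s x h n (n + 1) = s + x := by
  have : (n : ℝ≥0) + 1 ≠ 0 := by positivity
  simp only [grid, le_refl, if_true]
  push_cast
  rw [mul_div_cancel₀ _ this]

lemma grid_end (s x h : ℝ≥0) (n : ℕ) : grid s x h n (n + 2) = s + x + h := by simp [grid]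

lemma grid_mono (s x h : ℝ≥0) (n : ℕ) : Monotone (grid s x h n) := by
  refine monotone_nat_of_le_succ fun i => ?_
  rcases lt_trichotomy i (n + 1) with hi | rfl | hi
  · rw [grid, grid, if_pos hi.le, if_pos (by omega)]
    gcongr
    simp
  · rw [grid_last, grid_end]
    exact le_self_add
  · rw [grid, grid, if_neg (by omega), if_neg (by omega)]

lemma grid_succ (s x h : ℝ≥0) {n i : ℕ} (hi : i < n + 1) :
    grid s x h n (i + 1) = grid s x h n i + x / (n + 1) := by
  rw [grid, grid, if_pos hi.le, if_pos (by omega)]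
  push_cast
  ring

lemma grid_sub (s x h : ℝ≥0) (n i : ℕ) :
    grid s x h n (i + 1) - grid s x h n i = grid 0 x h n (i + 1) - grid 0 x h n i := by
  have : ∀ i, grid s x h n i = s + grid 0 x h n i := by
    intro i
    unfold grid
    split_ifs <;> ring
  rw [this, this, add_tsub_add_eq_tsub_left]

section Clocks

variable {Ω : Type*} {R : V → V → Ω → Set ℝ≥0}

/-- The number of rings of each clock in each cell of the grid. -/
noncomputable def cells (R : V → V → Ω → Set ℝ≥0) (τ : ℕ → ℝ≥0) (ω : Ω) (p : (V × V) × ℕ) : ℕ :=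
  ringCount (R p.1.1 p.1.2 ω) (τ (p.2 + 1)) - ringCount (R p.1.1 p.1.2 ω) (τ p.2)

/-- The event that `S` is informed of the state of the source at some time `≥ s` by time `t`. -/
def informedSet (R : V → V → Ω → Set ℝ≥0) (n₀ : V) (S : Set V) (s t : ℝ≥0) : Set Ω :=
  {ω | ∃ v ∈ S, Informed (fun u v => R u v ω) n₀ s v t}

/-- The event that the clock `e` rings in the time interval `(a, b]`. -/
def rung (R : V → V → Ω → Set ℝ≥0) (a b : ℝ≥0) (e : V × V) : Set Ω :=
  {ω | ∃ r ∈ R e.1 e.2 ω, r ∈ Ioc a b}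

/-- Each round makes a hop only from a node informed by the start of the cell, so `spread` yields
genuine chains. It may miss chains with two hops in one cell. -/
lemma informed_of_mem_spread {n₀ v : V} (hR : ∀ u v ω t, (R u v ω ∩ Iic t).Finite) {τ : ℕ → ℝ≥0}
    (hτ : Monotone τ) {ω : Ω} {i : ℕ} (h : v ∈ spread n₀ (cells R τ ω) i) :
    Informed (fun u v => R u v ω) n₀ (τ 0) v (τ i) := by
  induction i generalizing v with
  | zero =>
    rw [spread, mem_singleton_iff] at h
    subst h
    exact .source le_rfl
  | succ i ih =>
    rcases h with h | ⟨u, hu, h⟩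
    · exact (ih h).mono (hτ i.le_succ)
    · obtain ⟨r, hr, hr'⟩ := (ringCount_sub_ne_zero_iff (hR u v ω) (hτ i.le_succ)).1 h
      exact .step (ih hu) hr'.1 hr hr'.2

/-- A chain has finitely many hops at strictly increasing times, so on a fine enough grid successive
hops fall into different cells and none is missed. -/
lemma eventually_mem_spread {n₀ v : V} (hR : ∀ u v ω t, (R u v ω ∩ Iic t).Finite) {ω : Ω}
    {s t : ℝ≥0} (x h : ℝ≥0) (hi : Informed (fun u v => R u v ω) n₀ s v t) :
    ∀ᶠ n in atTop, ∀ i ≤ n + 1, t ≤ grid s x h n i →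
      v ∈ spread n₀ (cells R (grid s x h n) ω) i := by
  induction hi with
  | source _ =>
    exact Eventually.of_forall fun n i _ _ => spread_mono _ _ (Nat.zero_le i) rfl
  | @step u v r r' t h1 h2 h3 h4 ih =>
    have hmesh : ∀ᶠ n : ℕ in atTop, x / ((n : ℝ≥0) + 1) < r' - r := by
      obtain ⟨m, hm⟩ := exists_nat_gt (x / (r' - r))
      filter_upwards [eventually_ge_atTop m] with n hn
      rw [div_lt_iff₀ (by positivity), mul_comm]
      rw [div_lt_iff₀ (tsub_pos_of_lt h2)] at hm
      refine hm.trans_le ?_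
      gcongr
      exact (Nat.cast_le.2 hn).trans (le_add_of_nonneg_right zero_le_one)
    filter_upwards [ih, hmesh] with n hn hm i hi hti
    have hex : ∃ j, r' ≤ grid s x h n j := ⟨i, h4.trans hti⟩
    classical
    have hspec := Nat.find_spec hex
    have hle : Nat.find hex ≤ i := Nat.find_min' hex (h4.trans hti)
    have hmin : ∀ j < Nat.find hex, grid s x h n j < r' := fun j hj =>
      not_le.1 (Nat.find_min hex hj)
    -- Grid point `k` is the first one at or after `r'`. The cell ending there contains `r'`, and by
    -- the mesh bound it starts no earlier than `r`, when `u` is already informed.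
    generalize Nat.find hex = k at hspec hle hmin
    cases k with
    | zero =>
      rw [grid_zero] at hspec
      exact absurd (h1.le.trans_lt h2) (not_lt.2 hspec)
    | succ j =>
      refine spread_mono _ _ hle (Or.inr ⟨u, hn j (by omega) ?_, ?_⟩)
      · rw [grid_succ _ _ _ (by omega)] at hspec
        rw [lt_tsub_iff_right] at hm
        by_contra! hc
        have : grid s x h n j + x / (n + 1) < r' := by
          rw [add_comm]
          exact lt_trans (by gcongr) hm
        exact absurd hspec (not_le.2 this)
      · exact (ringCount_sub_ne_zero_iff (hR u v ω) (grid_mono _ _ _ _ j.le_succ)).2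
          ⟨r', h3, hmin j j.lt_succ_self, hspec⟩

end Clocks

/-! ### Stationarity and independence of the clocks. -/

section Probability

variable {G : GossipNetwork V} {Ω : Type*} [MeasurableSpace Ω] {P : Measure Ω}
  {R : V → V → Ω → Set ℝ≥0}

lemma IsClocks.finite (hR : G.IsClocks R P) (u v : V) (ω : Ω) (t : ℝ≥0) :
    (R u v ω ∩ Iic t).Finite := (hR.poisson u v).locallyFinite ω t

lemma IsClocks.measurable_cells (hR : G.IsClocks R P) (τ : ℕ → ℝ≥0) (p : (V × V) × ℕ) :
    Measurable fun ω => cells R τ ω p :=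
  ((hR.poisson _ _).measurable _).sub ((hR.poisson _ _).measurable _)

/-- Independence between clocks and independence of the increments of each clock combine into joint
independence over all pairs of an edge and a cell. -/
lemma IsClocks.iIndepFun_cells (hR : G.IsClocks R P) {τ : ℕ → ℝ≥0} (hτ : Monotone τ) :
    iIndepFun (fun p ω => cells R τ ω p) P := by
  refine iIndepFun_uncurry' (X := fun (e : V × V) (i : ℕ) ω => cells R τ ω (e, i))
    (fun e i => hR.measurable_cells τ (e, i)) ?_ fun e => (hR.poisson e.1 e.2).indep.nat hτ
  exact hR.indep.comp (fun _ f i => f (τ (i + 1)) - f (τ i)) fun _ => by fun_prop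

lemma IsClocks.map_cells [Countable V] [IsProbabilityMeasure P] (hR : G.IsClocks R P) {τ : ℕ → ℝ≥0}
    (hτ : Monotone τ) : P.map (cells R τ) = Measure.infinitePi fun p : (V × V) × ℕ =>
      poissonMeasure (G.rate p.1.1 p.1.2 * (τ (p.2 + 1) - τ p.2)) :=
  ((hR.iIndepFun_cells hτ).hasLaw_infinitePi (fun p => (hR.poisson _ _).law _ _ (hτ p.2.le_succ))
    (measurable_pi_iff.2 (hR.measurable_cells τ)).aemeasurable).map_eq

lemma IsClocks.measurableSet_informedSet_and_tendsto [Countable V] [IsProbabilityMeasure P]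
    (hR : G.IsClocks R P) (S : Set V) (s x h : ℝ≥0) :
    MeasurableSet (informedSet R G.source S s (s + x)) ∧ ∀ E, MeasurableSet E →
      Tendsto
        (fun n => P ({ω | ∃ v ∈ S, v ∈ spread G.source (cells R (grid s x h n) ω) (n + 1)} ∩ E))
        atTop (𝓝 (P (informedSet R G.source S s (s + x) ∩ E))) := by
  have hmeas : ∀ n, MeasurableSet
      {ω | ∃ v ∈ S, v ∈ spread G.source (cells R (grid s x h n) ω) (n + 1)} := fun n =>
    measurableSet_exists_mem_spread _ _ _ (fun e j _ => hR.measurable_cells _ _) S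
  have hsub : ∀ n, {ω | ∃ v ∈ S, v ∈ spread G.source (cells R (grid s x h n) ω) (n + 1)} ⊆
      informedSet R G.source S s (s + x) := by
    rintro n ω ⟨v, hv, hi⟩
    have := informed_of_mem_spread hR.finite (grid_mono s x h n) hi
    rw [grid_zero, grid_last] at this
    exact ⟨v, hv, this⟩
  have hev : ∀ ω ∈ informedSet R G.source S s (s + x), ∀ᶠ n in atTop,
      ω ∈ {ω | ∃ v ∈ S, v ∈ spread G.source (cells R (grid s x h n) ω) (n + 1)} := by
    rintro ω ⟨v, hv, hi⟩
    filter_upwards [eventually_mem_spread hR.finite x h hi] with n hn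
    exact ⟨v, hv, hn _ le_rfl (grid_last _ _ _ _).ge⟩
  refine ⟨?_, fun E hE => tendsto_measure_inter_of_eventually_mem P hmeas hsub hev hE⟩
  have : informedSet R G.source S s (s + x) =
      ⋃ n, {ω | ∃ v ∈ S, v ∈ spread G.source (cells R (grid s x h n) ω) (n + 1)} := by
    refine subset_antisymm (fun ω hω => ?_) (iUnion_subset hsub)
    obtain ⟨n, hn⟩ := (hev ω hω).exists
    exact mem_iUnion.2 ⟨n, hn⟩
  rw [this]
  exact MeasurableSet.iUnion hmeas

lemma IsClocks.measurableSet_informedSet [Countable V] [IsProbabilityMeasure P] (hR : G.IsClocks R P)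
    (S : Set V) (s x : ℝ≥0) : MeasurableSet (informedSet R G.source S s (s + x)) :=
  (hR.measurableSet_informedSet_and_tendsto S s x 0).1

/-- The clocks are stationary. -/
lemma IsClocks.measure_informedSet [Countable V] [IsProbabilityMeasure P] (hR : G.IsClocks R P)
    (S : Set V) (s x : ℝ≥0) :
    P (informedSet R G.source S s (s + x)) = P (informedSet R G.source S 0 x) := by
  have h1 := (hR.measurableSet_informedSet_and_tendsto S s x 0).2 univ .univ
  have h2 := (hR.measurableSet_informedSet_and_tendsto S 0 x 0).2 univ .univ
  simp only [inter_univ, zero_add] at h1 h2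
  refine tendsto_nhds_unique h1 (h2.congr fun n => ?_)
  -- The joint law of the counts depends only on the cell lengths, hence not on `s`.
  have key : ∀ s, P {ω | ∃ v ∈ S, v ∈ spread G.source (cells R (grid s x 0 n) ω) (n + 1)} =
      (Measure.infinitePi fun p : (V × V) × ℕ => poissonMeasure (G.rate p.1.1 p.1.2 *
        (grid 0 x 0 n (p.2 + 1) - grid 0 x 0 n p.2)))
          {Y | ∃ v ∈ S, v ∈ spread G.source Y (n + 1)} := by
    intro s
    have := hR.map_cells (grid_mono s x 0 n)
    simp only [grid_sub s x] at this
    rw [← this, Measure.map_apply (measurable_pi_iff.2 (hR.measurable_cells _))]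
    · rfl
    · exact measurableSet_exists_mem_spread _ _ _ (fun e j _ => measurable_pi_apply (e, j)) S
  rw [key, key]

/-- Rings after time `s + x` are independent of what is known at time `s + x`. -/
lemma IsClocks.measure_informedSet_inter [Countable V] [IsProbabilityMeasure P] (hR : G.IsClocks R P)
    (S : Set V) (s x h : ℝ≥0) {E : Set Ω}
    (hE : MeasurableSet[MeasurableSpace.generateFrom (range (rung R (s + x) (s + x + h)))] E) :
    P (informedSet R G.source S s (s + x) ∩ E) =
      P (informedSet R G.source S s (s + x)) * P E := by
  -- Cell `n + 1` of the grid is exactly `(s + x, s + x + h]`, while `n + 1` rounds of `spread` use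
  -- only the cells `0, …, n`.
  have hle : ∀ n, MeasurableSpace.generateFrom (range (rung R (s + x) (s + x + h))) ≤
      ⨆ p ∈ {p : (V × V) × ℕ | p.2 = n + 1},
        MeasurableSpace.comap (fun ω => cells R (grid s x h n) ω p) inferInstance := by
    intro n
    refine MeasurableSpace.generateFrom_le ?_
    rintro _ ⟨e, rfl⟩
    refine (le_iSup₂_of_le (f := fun p (_ : p ∈ {p : (V × V) × ℕ | p.2 = n + 1}) =>
      MeasurableSpace.comap (fun ω => cells R (grid s x h n) ω p) inferInstance)
      (e, n + 1) rfl le_rfl) _ ⟨{k | k ≠ 0}, .of_discrete, ?_⟩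
    ext ω
    have := ringCount_sub_ne_zero_iff (hR.finite e.1 e.2 ω) (le_self_add : s + x ≤ s + x + h)
    rw [rung, mem_ofPred_eq, ← this]
    simp only [cells, grid_last, grid_end, mem_preimage, mem_ofPred_eq]
  have hcomap : ∀ n p, MeasurableSpace.comap (fun ω => cells R (grid s x h n) ω p) inferInstance ≤
      (inferInstance : MeasurableSpace Ω) := fun n p => (hR.measurable_cells _ p).comap_le
  have hE' : MeasurableSet E := (hle 0).trans (iSup₂_le fun p _ => hcomap 0 p) _ hE
  obtain ⟨-, ht⟩ := hR.measurableSet_informedSet_and_tendsto S s x h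
  have h1 := ht E hE'
  have h2 := ENNReal.Tendsto.mul_const (ht univ .univ) (b := P E) (Or.inr (measure_ne_top _ _))
  simp only [inter_univ] at h2
  refine tendsto_nhds_unique h1 (h2.congr fun n => ?_)
  have hind := indep_iSup_of_disjoint (hcomap n) (hR.iIndepFun_cells (grid_mono s x h n)).iIndep
    (S := {p | p.2 < n + 1}) (T := {p | p.2 = n + 1})
    (Set.disjoint_left.2 fun p (hp : p.2 < n + 1) (hp' : p.2 = n + 1) => by omega)
  refine ((Indep_iff _ _ _).1 hind _ E ?_ (hle n E hE)).symm
  refine measurableSet_exists_mem_spread _ _ _ (fun e j hj => ?_) S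
  refine Measurable.mono (comap_measurable _) (le_iSup₂_of_le
    (f := fun p (_ : p ∈ {p : (V × V) × ℕ | p.2 < n + 1}) =>
      MeasurableSpace.comap (fun ω => cells R (grid s x h n) ω p) inferInstance)
      (e, j) hj le_rfl) le_rfl

lemma IsClocks.rung_eq_preimage (hR : G.IsClocks R P) {a b : ℝ≥0} (hab : a ≤ b) (e : V × V) :
    rung R a b e = (fun ω t => ringCount (R e.1 e.2 ω) t) ⁻¹' {f | f b - f a ≠ 0} := by
  ext ω
  simp only [rung, mem_ofPred_eq, mem_preimage]
  rw [← ringCount_sub_ne_zero_iff (hR.finite e.1 e.2 ω) hab]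

lemma measurableSet_counts (a b : ℝ≥0) : MeasurableSet {f : ℝ≥0 → ℕ | f b - f a ≠ 0} := by
  have : Measurable fun f : ℝ≥0 → ℕ => f b - f a := by fun_prop
  exact this (.of_discrete : MeasurableSet {n : ℕ | n ≠ 0})

lemma IsClocks.measurableSet_rung (hR : G.IsClocks R P) {a b : ℝ≥0} (hab : a ≤ b) (e : V × V) :
    MeasurableSet (rung R a b e) := by
  rw [hR.rung_eq_preimage hab]
  exact (measurable_pi_iff.2 fun t => (hR.poisson _ _).measurable t) (measurableSet_counts a b)

lemma IsClocks.measure_rung_inter (hR : G.IsClocks R P) {a b : ℝ≥0} (hab : a ≤ b) {e f : V × V}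
    (hef : e ≠ f) : P (rung R a b e ∩ rung R a b f) = P (rung R a b e) * P (rung R a b f) := by
  rw [hR.rung_eq_preimage hab, hR.rung_eq_preimage hab]
  exact (hR.indep.indepFun hef).measure_inter_preimage_eq_mul _ _ (measurableSet_counts a b)
    (measurableSet_counts a b)

lemma IsClocks.measure_rung (hR : G.IsClocks R P) {a b : ℝ≥0} (hab : a ≤ b) (e : V × V) :
    P (rung R a b e) = ENNReal.ofReal (1 - Real.exp (-(G.rate e.1 e.2 * (b - a) : ℝ≥0))) := by
  rw [← poissonMeasure_ne_zero, ← ((hR.poisson e.1 e.2).law a b hab).measure_eq (.of_discrete)]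
  congr 1
  ext ω
  rw [rung, mem_ofPred_eq, ← ringCount_sub_ne_zero_iff (hR.finite e.1 e.2 ω) hab]
  rfl

lemma IsClocks.measure_rung_le (hR : G.IsClocks R P) (a h : ℝ≥0) (e : V × V) :
    P (rung R a (a + h) e) ≤ G.rate e.1 e.2 * h := by
  rw [hR.measure_rung le_self_add, add_tsub_cancel_left, ← ENNReal.coe_mul,
    ← ENNReal.ofReal_coe_nnreal]
  refine ENNReal.ofReal_le_ofReal ?_
  linarith [Real.add_one_le_exp (-((G.rate e.1 e.2 * h : ℝ≥0) : ℝ))]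

lemma IsClocks.le_measure_rung (hR : G.IsClocks R P) (a h : ℝ≥0) (e : V × V) :
    G.rate e.1 e.2 * h * (1 - G.rate e.1 e.2 * h) ≤ P (rung R a (a + h) e) := by
  rw [hR.measure_rung le_self_add, add_tsub_cancel_left]
  rw [← ENNReal.coe_mul]
  generalize G.rate e.1 e.2 * h = y
  rcases le_total 1 y with hy | hy
  · have : (1 : ℝ≥0∞) ≤ y := by exact_mod_cast hy
    simp [tsub_eq_zero_of_le this]
  · rw [← ENNReal.coe_one, ← ENNReal.coe_sub, ← ENNReal.coe_mul, ← ENNReal.ofReal_coe_nnreal]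
    refine ENNReal.ofReal_le_ofReal ?_
    rw [NNReal.coe_mul, NNReal.coe_sub hy, NNReal.coe_one]
    have h0 : (0 : ℝ) ≤ y := y.2
    -- `e^{-y} ≤ 1/(1 + y) ≤ 1 - y + y²`; the second inequality holds because `(1 - y + y²)(1 + y) =
    -- 1 + y³`.
    have h1 : Real.exp (-(y : ℝ)) ≤ (1 + y : ℝ)⁻¹ := by
      rw [Real.exp_neg]
      gcongr
      linarith [Real.add_one_le_exp (y : ℝ)]
    have h2 : (1 + y : ℝ)⁻¹ ≤ 1 - y * (1 - y) := by
      rw [inv_le_iff_one_le_mul₀ (by positivity)]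
      nlinarith [pow_nonneg h0 3]
    linarith

end Probability

/-! ### Extending the window by a short interval. -/

/-- All pairs that enter `S`. -/
def cut (S : Set V) : Set (V × V) := {e | e.1 ∉ S ∧ e.2 ∈ S}

/-- The total rate into `S`, from the source and from other nodes. -/
noncomputable def cutRate (G : GossipNetwork V) (S : Set V) : ℝ≥0∞ :=
  ∑' e : cut S, (G.rate e.1.1 e.1.2 : ℝ≥0∞)

/-- Follow the chain backwards from `v` inside `S`: either it is still in `S` at a hop not after `t`
(or at the source), or it leaves `S` through a hop after `t`. -/
lemma Informed.mem_or_crosses {ring : V → V → Set ℝ≥0} {n₀ : V} {S : Set V} {s t t' : ℝ≥0} {v : V}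
    (h : Informed ring n₀ s v t') (hv : v ∈ S) (hst : s ≤ t) :
    (∃ w ∈ S, Informed ring n₀ s w t) ∨ ∃ e ∈ cut S, ∃ r, Informed ring n₀ s e.1 r ∧
      ∃ r' ∈ ring e.1 e.2, r < r' ∧ r' ∈ Ioc t t' := by
  induction h with
  | source h => exact Or.inl ⟨_, hv, .source hst⟩
  | @step u v r r' t' h1 h2 h3 h4 ih =>
    by_cases hr : r' ≤ t
    · exact Or.inl ⟨v, hv, .step h1 h2 h3 hr⟩
    by_cases hu : u ∈ S
    · rcases ih hu with h | ⟨e, he, q, hq, q', hq', hlt, hm⟩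
      · exact Or.inl h
      · exact Or.inr ⟨e, he, q, hq, q', hq', hlt, hm.1, hm.2.trans (h2.le.trans h4)⟩
    · exact Or.inr ⟨(u, v), ⟨hu, hv⟩, r, h1, r', h3, h2, not_le.1 hr, h4⟩

section Step

variable {Ω : Type*} {R : V → V → Ω → Set ℝ≥0} {n₀ : V}

lemma informedSet_mono {S T : Set V} (h : S ⊆ T) (s t : ℝ≥0) :
    informedSet R n₀ S s t ⊆ informedSet R n₀ T s t := fun _ ⟨v, hv, hi⟩ => ⟨v, h hv, hi⟩

lemma informedSet_mono_time (S : Set V) (s : ℝ≥0) : Monotone (informedSet R n₀ S s) :=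
  fun _ _ h _ ⟨v, hv, hi⟩ => ⟨v, hv, hi.mono h⟩

lemma informedSet_of_mem {S : Set V} (h : n₀ ∈ S) {s t : ℝ≥0} (hst : s ≤ t) :
    informedSet R n₀ S s t = univ :=
  eq_univ_of_forall fun _ => ⟨n₀, h, .source hst⟩

/-- `mem_or_crosses` is applied twice. If `S` becomes informed through `e`, then either `S ∪ e` was
informed by time `t`, or a second edge, into `S ∪ e`, rings in the short interval too; the latter is
of second order. -/
lemma informedSet_subset (S : Set V) {s t : ℝ≥0} (hst : s ≤ t) (t' : ℝ≥0) :
    informedSet R n₀ S s t' ⊆ informedSet R n₀ S s t ∪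
      ((⋃ e : cut S, (informedSet R n₀ (S ∪ {e.1.1, e.1.2}) s t \ informedSet R n₀ S s t) ∩
        rung R t t' e) ∪
      ⋃ e : cut S, rung R t t' e ∩ ⋃ f : cut (S ∪ {e.1.1, e.1.2}), rung R t t' f) := by
  rintro ω ⟨v, hv, hi⟩
  by_cases hω : ω ∈ informedSet R n₀ S s t
  · exact Or.inl hω
  rcases hi.mem_or_crosses hv hst with h | ⟨e, he, r, hr, r', hr', hlt, hm⟩
  · exact Or.inl h
  refine Or.inr ?_
  have hrung : ω ∈ rung R t t' e := ⟨r', hr', hm⟩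
  rcases hr.mem_or_crosses (S := S ∪ {e.1, e.2}) (Or.inr (Or.inl rfl)) hst with
    h | ⟨f, hf, -, -, q', hq', -, hm'⟩
  · exact Or.inl (mem_iUnion.2 ⟨⟨e, he⟩, ⟨h, hω⟩, hrung⟩)
  · exact Or.inr (mem_iUnion.2 ⟨⟨e, he⟩, hrung, mem_iUnion.2 ⟨⟨f, hf⟩, q', hq', hm'.1,
      hm'.2.trans (hlt.le.trans hm.2)⟩⟩)

lemma informedSet_inter_rung_subset {S : Set V} {s t t' : ℝ≥0} (htt' : t ≤ t') {e : V × V}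
    (he : e ∈ cut S) :
    informedSet R n₀ (S ∪ {e.1, e.2}) s t ∩ rung R t t' e ⊆ informedSet R n₀ S s t' := by
  rintro ω ⟨⟨v, hv, hi⟩, r', hr', hm⟩
  rcases hv with hv | rfl | rfl
  · exact ⟨v, hv, hi.mono htt'⟩
  · exact ⟨e.2, he.2, .step hi hm.1 hr' hm.2⟩
  · exact ⟨e.2, he.2, hi.mono htt'⟩

end Step

section Probability

variable [Countable V] {G : GossipNetwork V} {Ω : Type*} [MeasurableSpace Ω] {P : Measure Ω}
  [IsProbabilityMeasure P] {R : V → V → Ω → Set ℝ≥0}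

lemma IsClocks.measure_informedSet_diff_inter (hR : G.IsClocks R P) {S T : Set V} (hST : S ⊆ T)
    (x h : ℝ≥0) {E : Set Ω} (hm : MeasurableSet E)
    (hE : MeasurableSet[MeasurableSpace.generateFrom (range (rung R x (x + h)))] E) :
    P ((informedSet R G.source T 0 x \ informedSet R G.source S 0 x) ∩ E) =
      (P (informedSet R G.source T 0 x) - P (informedSet R G.source S 0 x)) * P E := by
  have key : ∀ S, P (informedSet R G.source S 0 x ∩ E) = P (informedSet R G.source S 0 x) * P E := by
    intro S
    have := hR.measure_informedSet_inter S 0 x h (E := E) (by rwa [zero_add])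
    simpa using this
  have hmeas : MeasurableSet (informedSet R G.source S 0 x) := by
    simpa using hR.measurableSet_informedSet S 0 x
  have : (informedSet R G.source T 0 x \ informedSet R G.source S 0 x) ∩ E =
      (informedSet R G.source T 0 x ∩ E) \ (informedSet R G.source S 0 x ∩ E) := by
    ext ω
    simp only [mem_inter_iff, Set.mem_sdiff]
    tauto
  rw [this, measure_sdiff (inter_subset_inter_left _ (informedSet_mono hST 0 x))
    (hmeas.inter hm).nullMeasurableSet (measure_ne_top _ _), key, key,
    ENNReal.sub_mul fun _ _ => measure_ne_top _ _]

/-- Union bound over `informedSet_subset`. The `min` with `1` serves infinite cuts: the rates into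
`S ∪ e` may be unbounded in `e`, and the trivial bound keeps the error series dominated by the
rates. -/
lemma IsClocks.measure_informedSet_add_le (hR : G.IsClocks R P) (S : Set V) (x h : ℝ≥0) :
    P (informedSet R G.source S 0 (x + h)) ≤ P (informedSet R G.source S 0 x) +
      ((∑' e : cut S, (P (informedSet R G.source (S ∪ {e.1.1, e.1.2}) 0 x) -
        P (informedSet R G.source S 0 x)) * (G.rate e.1.1 e.1.2 * h)) +
      ∑' e : cut S, G.rate e.1.1 e.1.2 * h * min 1 (G.cutRate (S ∪ {e.1.1, e.1.2}) * h)) := by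
  refine (measure_mono (informedSet_subset S (zero_le : 0 ≤ x) (x + h))).trans ?_
  refine (measure_union_le _ _).trans (add_le_add_right ?_ _)
  refine (measure_union_le _ _).trans (add_le_add ?_ ?_)
  · refine (measure_iUnion_le _).trans (ENNReal.tsum_le_tsum fun e => ?_)
    rw [hR.measure_informedSet_diff_inter subset_union_left x h (hR.measurableSet_rung le_self_add _)
      (MeasurableSpace.measurableSet_generateFrom ⟨_, rfl⟩)]
    gcongr
    exact hR.measure_rung_le _ _ _
  · refine (measure_iUnion_le _).trans (ENNReal.tsum_le_tsum fun e => ?_)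
    rw [mul_min, mul_one]
    refine le_min ((measure_mono inter_subset_left).trans (hR.measure_rung_le _ _ _)) ?_
    rw [inter_iUnion]
    refine (measure_iUnion_le _).trans ?_
    rw [cutRate, ← ENNReal.tsum_mul_right, ← ENNReal.tsum_mul_left]
    refine ENNReal.tsum_le_tsum fun f => ?_
    rw [hR.measure_rung_inter le_self_add]
    · gcongr <;> exact hR.measure_rung_le _ _ _
    · rintro hef
      exact f.2.1 (hef ▸ Or.inr (Or.inl rfl))

/-- The events that `e` is the only edge of the cut to ring are disjoint, so their probabilities add
up. One factor `1 - Λh` comes from the lower bound for a ring of `e`, the other from excluding all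
other edges. -/
lemma IsClocks.le_measure_informedSet_add (hR : G.IsClocks R P) (S : Set V) (x h : ℝ≥0) :
    P (informedSet R G.source S 0 x) +
      ∑' e : cut S, (P (informedSet R G.source (S ∪ {e.1.1, e.1.2}) 0 x) -
        P (informedSet R G.source S 0 x)) *
        (G.rate e.1.1 e.1.2 * h * (1 - G.cutRate S * h) * (1 - G.cutRate S * h)) ≤
    P (informedSet R G.source S 0 (x + h)) := by
  let E : cut S → Set Ω := fun e =>
    rung R x (x + h) e \ ⋃ f : {f : cut S // f ≠ e}, rung R x (x + h) f.1
  let D : cut S → Set Ω := fun e =>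
    (informedSet R G.source (S ∪ {e.1.1, e.1.2}) 0 x \ informedSet R G.source S 0 x) ∩ E e
  have hrung : ∀ e, MeasurableSet (rung R x (x + h) e) := hR.measurableSet_rung le_self_add
  have hE : ∀ e, MeasurableSet (E e) :=
    fun e => (hrung _).diff (MeasurableSet.iUnion fun f => hrung _)
  have hinf : ∀ S, MeasurableSet (informedSet R G.source S 0 x) := fun S => by
    simpa using hR.measurableSet_informedSet S 0 x
  have hD : ∀ e, MeasurableSet (D e) := fun e => ((hinf _).diff (hinf _)).inter (hE e)
  have hdisj : Pairwise (Function.onFun Disjoint D) := by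
    intro e f hef
    refine Set.disjoint_left.2 fun ω he hf => hf.2.2 (mem_iUnion.2 ⟨⟨e, hef⟩, he.2.1⟩)
  have hdisj' : Disjoint (informedSet R G.source S 0 x) (⋃ e, D e) :=
    Set.disjoint_left.2 fun ω h1 h2 => by
      obtain ⟨e, he⟩ := mem_iUnion.1 h2
      exact he.1.2 h1
  have hsub : informedSet R G.source S 0 x ∪ ⋃ e, D e ⊆ informedSet R G.source S 0 (x + h) := by
    refine union_subset (informedSet_mono_time S 0 le_self_add) (iUnion_subset fun e ω hω => ?_)
    exact informedSet_inter_rung_subset le_self_add e.2 ⟨hω.1.1, hω.2.1⟩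
  refine le_trans ?_ (measure_mono hsub)
  rw [measure_union hdisj' (MeasurableSet.iUnion hD), measure_iUnion hdisj hD]
  refine add_le_add_right (ENNReal.tsum_le_tsum fun e => ?_) _
  rw [hR.measure_informedSet_diff_inter subset_union_left x h (hE e) (MeasurableSet.diff
    (MeasurableSpace.measurableSet_generateFrom ⟨_, rfl⟩) (MeasurableSet.iUnion fun f =>
      MeasurableSpace.measurableSet_generateFrom ⟨_, rfl⟩))]
  gcongr
  have h1 : P (rung R x (x + h) e ∩ ⋃ f : {f : cut S // f ≠ e}, rung R x (x + h) f.1) ≤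
      P (rung R x (x + h) e) * (G.cutRate S * h) := by
    rw [inter_iUnion]
    refine (measure_iUnion_le _).trans ?_
    rw [cutRate, ← ENNReal.tsum_mul_right, ← ENNReal.tsum_mul_left]
    refine le_trans (ENNReal.tsum_le_tsum fun f => ?_) (ENNReal.tsum_comp_le_tsum_of_injective
      (f := Subtype.val (p := fun f : cut S => f ≠ e)) Subtype.val_injective
      (fun f : cut S => P (rung R x (x + h) e) * ((G.rate f.1.1 f.1.2 : ℝ≥0∞) * h)))
    rw [hR.measure_rung_inter le_self_add fun hef => f.2 (Subtype.ext hef.symm)]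
    gcongr
    exact hR.measure_rung_le _ _ _
  have h2 : (G.rate e.1.1 e.1.2 : ℝ≥0∞) * h ≤ G.cutRate S * h := by
    gcongr
    exact ENNReal.le_tsum (f := fun e : cut S => (G.rate e.1.1 e.1.2 : ℝ≥0∞)) e
  calc (G.rate e.1.1 e.1.2 * h * (1 - G.cutRate S * h) * (1 - G.cutRate S * h) : ℝ≥0∞)
      ≤ G.rate e.1.1 e.1.2 * h * (1 - G.rate e.1.1 e.1.2 * h) * (1 - G.cutRate S * h) := by gcongr
    _ ≤ P (rung R x (x + h) e) * (1 - G.cutRate S * h) := by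
        gcongr
        exact hR.le_measure_rung _ _ _
    _ = P (rung R x (x + h) e) - P (rung R x (x + h) e) * (G.cutRate S * h) := by
        rw [ENNReal.mul_sub fun _ _ => measure_ne_top _ _, mul_one]
    _ ≤ P (rung R x (x + h) e) - P (rung R x (x + h) e ∩
          ⋃ f : {f : cut S // f ≠ e}, rung R x (x + h) f.1) := by gcongr
    _ ≤ P (E e) := by
        rw [← measure_sdiff_add_inter (rung R x (x + h) e) (MeasurableSet.iUnion fun f :
          {f : cut S // f ≠ e} => hrung f.1)]
        exact tsub_le_iff_right.2 le_rfl

end Probability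

/-! ### Almost every realisation is regular. -/

lemma exists_mem_grid_cell {s x r : ℝ≥0} (hr : r ∈ Ioc s (s + x)) (n : ℕ) :
    ∃ i < n + 1, r ∈ Ioc (grid s x 0 n i) (grid s x 0 n (i + 1)) := by
  classical
  have hex : ∃ j, r ≤ grid s x 0 n j := ⟨n + 1, by rw [grid_last]; exact hr.2⟩
  have hspec := Nat.find_spec hex
  have hle : Nat.find hex ≤ n + 1 := Nat.find_min' hex (by rw [grid_last]; exact hr.2)
  have hmin : ∀ j < Nat.find hex, grid s x 0 n j < r := fun j hj => not_le.1 (Nat.find_min hex hj)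
  generalize Nat.find hex = k at hspec hle hmin
  cases k with
  | zero =>
    rw [grid_zero] at hspec
    exact absurd hr.1 (not_lt.2 hspec)
  | succ j => exact ⟨j, by omega, hmin j j.lt_succ_self, hspec⟩

section Regular

variable {G : GossipNetwork V} {Ω : Type*} [MeasurableSpace Ω] {P : Measure Ω}
  {R : V → V → Ω → Set ℝ≥0}

lemma IsClocks.ae_empty (hR : G.IsClocks R P) {e : V × V} (he : G.rate e.1 e.2 = 0) :
    ∀ᵐ ω ∂P, R e.1 e.2 ω = ∅ := by
  have h : ∀ n : ℕ, ∀ᵐ ω ∂P, ω ∉ rung R 0 n e := fun n => by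
    rw [← measure_eq_zero_iff_ae_notMem, hR.measure_rung zero_le, he]
    simp
  filter_upwards [ae_all_iff.2 h] with ω hω
  refine eq_empty_of_forall_notMem fun r hr => ?_
  obtain ⟨n, hn⟩ := exists_nat_ge r
  exact hω n ⟨r, hr, (hR.poisson _ _).pos ω r hr, hn⟩

/-- A common ring falls into one of `n + 1` cells, in each of which both clocks ring with
probability `O(1/(n + 1)²)`; the sum is `O(1/(n + 1))`. -/
lemma IsClocks.measure_simultaneous (hR : G.IsClocks R P) {e f : V × V} (hef : e ≠ f) (T : ℝ≥0) :
    P {ω | ∃ r ∈ Ioc 0 T, r ∈ R e.1 e.2 ω ∧ r ∈ R f.1 f.2 ω} = 0 := by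
  set c : ℝ≥0 := (G.rate e.1 e.2 * T) * (G.rate f.1 f.2 * T) with hc
  have hle : ∀ n : ℕ, P {ω | ∃ r ∈ Ioc 0 T, r ∈ R e.1 e.2 ω ∧ r ∈ R f.1 f.2 ω} ≤
      (c / (n + 1) : ℝ≥0) := by
    intro n
    have hsub : {ω | ∃ r ∈ Ioc 0 T, r ∈ R e.1 e.2 ω ∧ r ∈ R f.1 f.2 ω} ⊆
        ⋃ i ∈ Finset.range (n + 1), (rung R (grid 0 T 0 n i) (grid 0 T 0 n (i + 1)) e ∩
          rung R (grid 0 T 0 n i) (grid 0 T 0 n (i + 1)) f) := by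
      rintro ω ⟨r, hr, h1, h2⟩
      obtain ⟨i, hi, hri⟩ := exists_mem_grid_cell (s := 0) (x := T) (by simpa using hr) n
      exact mem_iUnion₂.2 ⟨i, Finset.mem_range.2 hi, ⟨r, h1, hri⟩, ⟨r, h2, hri⟩⟩
    refine (measure_mono hsub).trans ((measure_biUnion_finset_le _ _).trans ?_)
    have : ∀ i ∈ Finset.range (n + 1), P (rung R (grid 0 T 0 n i) (grid 0 T 0 n (i + 1)) e ∩
        rung R (grid 0 T 0 n i) (grid 0 T 0 n (i + 1)) f) ≤
        ((G.rate e.1 e.2 * (T / (n + 1))) * (G.rate f.1 f.2 * (T / (n + 1))) : ℝ≥0) := by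
      intro i hi
      rw [hR.measure_rung_inter (grid_mono _ _ _ _ i.le_succ) hef,
        grid_succ _ _ _ (Finset.mem_range.1 hi)]
      push_cast
      rw [← ENNReal.coe_mul, ← ENNReal.coe_mul]
      refine (mul_le_mul' (hR.measure_rung_le _ _ _) (hR.measure_rung_le _ _ _)).trans ?_
      push_cast
      exact le_rfl
    refine (Finset.sum_le_sum this).trans ?_
    rw [Finset.sum_const, Finset.card_range, nsmul_eq_mul, ← ENNReal.coe_natCast, ← ENNReal.coe_mul,
      ENNReal.coe_le_coe]
    have hn : (n : ℝ≥0) + 1 ≠ 0 := by positivity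
    refine le_of_eq ?_
    rw [hc]
    push_cast
    field_simp
  refine le_antisymm (ge_of_tendsto' (x := atTop) (f := fun n : ℕ => ((c / (n + 1) : ℝ≥0) : ℝ≥0∞))
    ?_ hle) zero_le
  rw [← ENNReal.coe_zero, ENNReal.tendsto_coe, ← NNReal.tendsto_coe]
  have := (tendsto_const_div_atTop_nhds_zero_nat (c : ℝ)).comp (tendsto_add_atTop_nat 1)
  refine this.congr fun n => ?_
  simp

lemma IsClocks.ae_disjoint (hR : G.IsClocks R P) {e f : V × V} (hef : e ≠ f) :
    ∀ᵐ ω ∂P, Disjoint (R e.1 e.2 ω) (R f.1 f.2 ω) := by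
  have h : ∀ n : ℕ, ∀ᵐ ω ∂P, ω ∉ {ω | ∃ r ∈ Ioc 0 (n : ℝ≥0), r ∈ R e.1 e.2 ω ∧ r ∈ R f.1 f.2 ω} :=
    fun n => measure_eq_zero_iff_ae_notMem.1 (hR.measure_simultaneous hef n)
  filter_upwards [ae_all_iff.2 h] with ω hω
  refine Set.disjoint_left.2 fun r hr hr' => ?_
  obtain ⟨n, hn⟩ := exists_nat_ge r
  exact hω n ⟨r, ⟨(hR.poisson _ _).pos ω r hr, hn⟩, hr, hr'⟩

lemma IsClocks.ae_isRegular [Countable V] (hR : G.IsClocks R P) :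
    ∀ᵐ ω ∂P, G.IsRegular fun u v => R u v ω := by
  have h1 : ∀ᵐ ω ∂P, ∀ e : V × V, G.rate e.1 e.2 = 0 → R e.1 e.2 ω = ∅ :=
    ae_all_iff.2 fun e => by
      by_cases he : G.rate e.1 e.2 = 0
      · filter_upwards [hR.ae_empty he] with ω hω using fun _ => hω
      · exact Eventually.of_forall fun _ h => absurd h he
  have h2 : ∀ᵐ ω ∂P, ∀ e f : V × V, e ≠ f → Disjoint (R e.1 e.2 ω) (R f.1 f.2 ω) :=
    ae_all_iff.2 fun e => ae_all_iff.2 fun f => by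
      by_cases hef : e = f
      · exact Eventually.of_forall fun _ h => absurd hef h
      · filter_upwards [hR.ae_disjoint hef] with ω hω using fun _ => hω
  filter_upwards [h1, h2] with ω hω hω'
  exact ⟨fun u v t => hR.finite u v ω t, fun u v h => hω (u, v) h,
    fun u u' v h => hω' (u, v) (u', v) (by simp [h])⟩

end Regular

/-! ### Finiteness of the total rates. -/

section CutRate

variable {G : GossipNetwork V} {S : Set V}

lemma summable_rate_cut (hS : G.cutRate S ≠ ∞) :
    Summable fun e : cut S => (G.rate e.1.1 e.1.2 : ℝ) :=
  NNReal.summable_coe.2 (ENNReal.tsum_coe_ne_top_iff_summable.1 hS)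

lemma toReal_cutRate :
    (G.cutRate S).toReal = ∑' e : cut S, (G.rate e.1.1 e.1.2 : ℝ) := by
  rw [cutRate, ENNReal.tsum_toReal_eq fun _ => ENNReal.coe_ne_top]
  rfl

/-- The only new entering edges are those into `e.1`, and finitely many of them have positive rate.
Thus the recursion never leaves the sets of finite rate. -/
lemma cutRate_union_ne_top (hS : G.cutRate S ≠ ∞) {e : V × V} (he : e ∈ cut S) :
    G.cutRate (S ∪ {e.1, e.2}) ≠ ∞ := by
  have hsub : ∀ f : V × V, f ∈ cut (S ∪ {e.1, e.2}) → f ∈ cut S ∪ {f | f.2 = e.1} := by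
    rintro f ⟨h1, h2 | h2 | h2⟩
    · exact Or.inl ⟨fun h => h1 (Or.inl h), h2⟩
    · exact Or.inr h2
    · refine Or.inl ⟨fun h => h1 (Or.inl h), ?_⟩
      rw [mem_singleton_iff.1 h2]
      exact he.2
  have hin : ∑' f : {f : V × V | f.2 = e.1}, (G.rate f.1.1 f.1.2 : ℝ≥0∞) ≠ ∞ := by
    let φ : {f : V × V | f.2 = e.1} → V := fun f => f.1.1
    have hφ : Function.Injective φ := fun f g h => Subtype.ext (Prod.ext h (f.2.trans g.2.symm))
    have : ∀ f : {f : V × V | f.2 = e.1}, (G.rate f.1.1 f.1.2 : ℝ≥0∞) = G.rate (φ f) e.1 := by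
      rintro ⟨⟨a, b⟩, hb⟩
      change b = e.1 at hb
      subst hb
      rfl
    rw [tsum_congr this]
    refine ne_top_of_le_ne_top ?_ (ENNReal.tsum_comp_le_tsum_of_injective hφ
      fun u => (G.rate u e.1 : ℝ≥0∞))
    rw [ENNReal.tsum_coe_ne_top_iff_summable]
    exact summable_of_hasFiniteSupport (G.finite_in e.1)
  refine ne_top_of_le_ne_top (ENNReal.add_ne_top.2 ⟨hS, hin⟩) ?_
  exact (ENNReal.tsum_mono_subtype (fun f : V × V => (G.rate f.1 f.2 : ℝ≥0∞)) hsub).trans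
    (ENNReal.tsum_union_le (fun f : V × V => (G.rate f.1 f.2 : ℝ≥0∞)) _ _)

end CutRate

/-! ### The derivative of the distribution function. -/

section Probability

variable {G : GossipNetwork V} {Ω : Type*} [MeasurableSpace Ω] {P : Measure Ω}
  {R : V → V → Ω → Set ℝ≥0}

/-- The probability that `S` is informed within a time window of length `x`. -/
noncomputable def reachProb (P : Measure Ω) (R : V → V → Ω → Set ℝ≥0) (n₀ : V) (S : Set V)
    (x : ℝ) : ℝ := P.real (informedSet R n₀ S 0 x.toNNReal)

lemma reachProb_nonneg (n₀ : V) (S : Set V) (x : ℝ) : 0 ≤ reachProb P R n₀ S x :=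
  measureReal_nonneg

lemma reachProb_le_one [IsProbabilityMeasure P] (n₀ : V) (S : Set V) (x : ℝ) :
    reachProb P R n₀ S x ≤ 1 :=
  measureReal_le_one

lemma reachProb_mono [IsProbabilityMeasure P] (n₀ : V) (S : Set V) : Monotone (reachProb P R n₀ S) :=
  fun _ _ h => measureReal_mono (informedSet_mono_time S 0 (Real.toNNReal_mono h))

lemma reachProb_mono_set [IsProbabilityMeasure P] (n₀ : V) (x : ℝ) {S T : Set V}
    (h : S ⊆ T) :
    reachProb P R n₀ S x ≤ reachProb P R n₀ T x :=
  measureReal_mono (informedSet_mono h 0 _)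

lemma reachProb_of_mem [IsProbabilityMeasure P] {n₀ : V} {S : Set V} (h : n₀ ∈ S) (x : ℝ) :
    reachProb P R n₀ S x = 1 := by
  rw [reachProb, informedSet_of_mem h zero_le, probReal_univ]

lemma ofReal_reachProb [IsProbabilityMeasure P] (n₀ : V) (S : Set V) (x : ℝ≥0) :
    ENNReal.ofReal (reachProb P R n₀ S x) = P (informedSet R n₀ S 0 x) := by
  rw [reachProb, Real.toNNReal_coe, ofReal_measureReal]

/-- The contribution of the edge `e` to the derivative of `reachProb`. -/
noncomputable def reachGap (G : GossipNetwork V) (P : Measure Ω) (R : V → V → Ω → Set ℝ≥0)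
    (S : Set V) (x : ℝ) (e : V × V) : ℝ :=
  G.rate e.1 e.2 * (reachProb P R G.source (S ∪ {e.1, e.2}) x - reachProb P R G.source S x)

/-- The derivative of `reachProb`. -/
noncomputable def reachDeriv (G : GossipNetwork V) (P : Measure Ω) (R : V → V → Ω → Set ℝ≥0)
    (S : Set V) (x : ℝ) : ℝ := ∑' e : cut S, reachGap G P R S x e

lemma reachProb_le_union [IsProbabilityMeasure P] (n₀ : V) (S : Set V) (x : ℝ) (e : V × V) :
    reachProb P R n₀ S x ≤ reachProb P R n₀ (S ∪ {e.1, e.2}) x :=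
  reachProb_mono_set _ _ subset_union_left

lemma reachGap_nonneg [IsProbabilityMeasure P] (S : Set V) (x : ℝ) (e : V × V) :
    0 ≤ reachGap G P R S x e :=
  mul_nonneg NNReal.zero_le_coe (sub_nonneg.2 (reachProb_le_union _ _ _ _))

lemma reachGap_le [IsProbabilityMeasure P] (S : Set V) (x : ℝ) (e : V × V) :
    reachGap G P R S x e ≤ G.rate e.1 e.2 := by
  have h2 : reachProb P R G.source (S ∪ {e.1, e.2}) x ≤ 1 := reachProb_le_one _ _ _
  have h3 : 0 ≤ reachProb P R G.source S x := reachProb_nonneg _ _ _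
  exact mul_le_of_le_one_right NNReal.zero_le_coe (by linarith)

lemma summable_reachGap [IsProbabilityMeasure P] {S : Set V} (hS : G.cutRate S ≠ ∞) (x : ℝ) :
    Summable fun e : cut S => reachGap G P R S x e :=
  Summable.of_nonneg_of_le (fun e => reachGap_nonneg S x e.1) (fun e => reachGap_le S x e.1)
    (summable_rate_cut hS)

lemma reachDeriv_nonneg [IsProbabilityMeasure P] (S : Set V) (x : ℝ) :
    0 ≤ reachDeriv G P R S x := tsum_nonneg fun e => reachGap_nonneg S x e.1

lemma reachDeriv_le [IsProbabilityMeasure P] {S : Set V} (hS : G.cutRate S ≠ ∞) (x : ℝ) :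
    reachDeriv G P R S x ≤ (G.cutRate S).toReal := by
  rw [toReal_cutRate]
  exact (summable_reachGap hS x).tsum_le_tsum (fun e => reachGap_le S x e.1) (summable_rate_cut hS)

lemma ofReal_reachGap [IsProbabilityMeasure P] (S : Set V) (x : ℝ≥0) (e : V × V) :
    ENNReal.ofReal (reachGap G P R S x e) = G.rate e.1 e.2 *
      (P (informedSet R G.source (S ∪ {e.1, e.2}) 0 x) - P (informedSet R G.source S 0 x)) := by
  rw [reachGap, ENNReal.ofReal_mul NNReal.zero_le_coe,
    ENNReal.ofReal_sub _ (reachProb_nonneg _ _ _), ofReal_reachProb, ofReal_reachProb,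
    ENNReal.ofReal_coe_nnreal]

/-- An upper bound for the rate at which `e` and another edge into `S ∪ e` ring within time `h`. -/
noncomputable def doubleRate (G : GossipNetwork V) (S : Set V) (h : ℝ) (e : V × V) : ℝ :=
  G.rate e.1 e.2 * min 1 ((G.cutRate (S ∪ {e.1, e.2})).toReal * h)

lemma doubleRate_nonneg (S : Set V) {h : ℝ} (hh : 0 ≤ h) (e : V × V) :
    0 ≤ doubleRate G S h e :=
  mul_nonneg NNReal.zero_le_coe (le_min zero_le_one (mul_nonneg ENNReal.toReal_nonneg hh))

lemma doubleRate_le (S : Set V) (h : ℝ) (e : V × V) : doubleRate G S h e ≤ G.rate e.1 e.2 :=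
  mul_le_of_le_one_right NNReal.zero_le_coe (min_le_left _ _)

lemma summable_doubleRate {S : Set V} (hS : G.cutRate S ≠ ∞) {h : ℝ} (hh : 0 ≤ h) :
    Summable fun e : cut S => doubleRate G S h e :=
  Summable.of_nonneg_of_le (fun e => doubleRate_nonneg S hh e.1) (fun e => doubleRate_le S h e.1)
    (summable_rate_cut hS)

lemma ofReal_doubleRate {S : Set V} (hS : G.cutRate S ≠ ∞) (h : ℝ≥0) {e : V × V}
    (he : e ∈ cut S) : ENNReal.ofReal (doubleRate G S h e) =
      G.rate e.1 e.2 * min 1 (G.cutRate (S ∪ {e.1, e.2}) * h) := by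
  rw [doubleRate, ENNReal.ofReal_mul NNReal.zero_le_coe, ENNReal.ofReal_min,
    ENNReal.ofReal_mul ENNReal.toReal_nonneg, ENNReal.ofReal_toReal (cutRate_union_ne_top hS he),
    ENNReal.ofReal_coe_nnreal, ENNReal.ofReal_coe_nnreal, ENNReal.ofReal_one]

lemma ofReal_reachDeriv [IsProbabilityMeasure P] {S : Set V} (hS : G.cutRate S ≠ ∞) (x : ℝ≥0) :
    ENNReal.ofReal (reachDeriv G P R S x) = ∑' e : cut S, G.rate e.1.1 e.1.2 *
      (P (informedSet R G.source (S ∪ {e.1.1, e.1.2}) 0 x) - P (informedSet R G.source S 0 x)) := by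
  rw [reachDeriv, ENNReal.ofReal_tsum_of_nonneg (f := fun e : cut S => reachGap G P R S x e)
    (fun e => reachGap_nonneg S _ e.1) (summable_reachGap hS _)]
  exact tsum_congr fun e => ofReal_reachGap S x e.1

lemma IsClocks.reachProb_add_le [Countable V] [IsProbabilityMeasure P] (hR : G.IsClocks R P)
    {S : Set V} (hS : G.cutRate S ≠ ∞) (x h : ℝ≥0) :
    reachProb P R G.source S (x + h) ≤ reachProb P R G.source S x +
      (h * reachDeriv G P R S x + h * ∑' e : cut S, doubleRate G S h e) := by
  have h0 : 0 ≤ h * reachDeriv G P R S x := mul_nonneg h.coe_nonneg (reachDeriv_nonneg S _)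
  have h1 : 0 ≤ h * ∑' e : cut S, doubleRate G S h e :=
    mul_nonneg h.coe_nonneg (tsum_nonneg fun e => doubleRate_nonneg S h.coe_nonneg e.1)
  have hp := reachProb_nonneg (P := P) (R := R) G.source S (x : ℝ)
  have e1 : ENNReal.ofReal (h * reachDeriv G P R S x) =
      ∑' e : cut S, (P (informedSet R G.source (S ∪ {e.1.1, e.1.2}) 0 x) -
        P (informedSet R G.source S 0 x)) * (G.rate e.1.1 e.1.2 * h) := by
    rw [ENNReal.ofReal_mul h.coe_nonneg, ofReal_reachDeriv hS, ENNReal.ofReal_coe_nnreal,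
      ← ENNReal.tsum_mul_left]
    exact tsum_congr fun e => by ring
  have e2 : ENNReal.ofReal (h * ∑' e : cut S, doubleRate G S h e) = ∑' e : cut S,
      G.rate e.1.1 e.1.2 * h * min 1 (G.cutRate (S ∪ {e.1.1, e.1.2}) * h) := by
    rw [ENNReal.ofReal_mul h.coe_nonneg,
      ENNReal.ofReal_tsum_of_nonneg (f := fun e : cut S => doubleRate G S h e)
        (fun e => doubleRate_nonneg S h.coe_nonneg e.1) (summable_doubleRate hS h.coe_nonneg),
      ENNReal.ofReal_coe_nnreal, ← ENNReal.tsum_mul_left]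
    refine tsum_congr fun e => ?_
    rw [ofReal_doubleRate hS h e.2]
    ring
  have key := hR.measure_informedSet_add_le S x h
  rw [← e1, ← e2, ← ENNReal.ofReal_add h0 h1, ← ofReal_reachProb, ← ofReal_reachProb,
    ← ENNReal.ofReal_add hp (add_nonneg h0 h1),
    ENNReal.ofReal_le_ofReal_iff (add_nonneg hp (add_nonneg h0 h1)), NNReal.coe_add] at key
  exact key

lemma IsClocks.le_reachProb_add [Countable V] [IsProbabilityMeasure P] (hR : G.IsClocks R P)
    {S : Set V} (hS : G.cutRate S ≠ ∞) (x h : ℝ≥0) (hh : (G.cutRate S).toReal * h ≤ 1) :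
    reachProb P R G.source S x +
      h * ((1 - (G.cutRate S).toReal * h) ^ 2 * reachDeriv G P R S x) ≤
    reachProb P R G.source S (x + h) := by
  have h0 : 0 ≤ reachDeriv G P R S x := reachDeriv_nonneg S _
  have hp := reachProb_nonneg (P := P) (R := R) G.source S (x : ℝ)
  have hsq : 0 ≤ 1 - (G.cutRate S).toReal * (h : ℝ) := sub_nonneg.2 hh
  have hΛ : ENNReal.ofReal (1 - (G.cutRate S).toReal * h) = 1 - G.cutRate S * h := by
    rw [ENNReal.ofReal_sub _ (mul_nonneg ENNReal.toReal_nonneg h.coe_nonneg),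
      ENNReal.ofReal_mul ENNReal.toReal_nonneg, ENNReal.ofReal_toReal hS,
      ENNReal.ofReal_coe_nnreal, ENNReal.ofReal_one]
  have e1 : ENNReal.ofReal (h * ((1 - (G.cutRate S).toReal * h) ^ 2 * reachDeriv G P R S x)) =
      ∑' e : cut S, (P (informedSet R G.source (S ∪ {e.1.1, e.1.2}) 0 x) -
        P (informedSet R G.source S 0 x)) *
        (G.rate e.1.1 e.1.2 * h * (1 - G.cutRate S * h) * (1 - G.cutRate S * h)) := by
    rw [ENNReal.ofReal_mul h.coe_nonneg, ENNReal.ofReal_mul (sq_nonneg _), pow_two,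
      ENNReal.ofReal_mul hsq, hΛ, ofReal_reachDeriv hS, ENNReal.ofReal_coe_nnreal, ← mul_assoc,
      ← ENNReal.tsum_mul_left]
    exact tsum_congr fun e => by ring
  have key := hR.le_measure_informedSet_add S x h
  rw [← e1, ← ofReal_reachProb, ← ofReal_reachProb,
    ← ENNReal.ofReal_add hp (mul_nonneg h.coe_nonneg (mul_nonneg (sq_nonneg _) h0)),
    ENNReal.ofReal_le_ofReal_iff (reachProb_nonneg _ _ _), NNReal.coe_add] at key
  exact key

lemma IsClocks.continuous_reachProb [Countable V] [IsProbabilityMeasure P]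
    (hR : G.IsClocks R P) {S : Set V} (hS : G.cutRate S ≠ ∞) :
    Continuous (reachProb P R G.source S) := by
  -- The derivative and the error from double rings contribute at most the total rate each, whence
  -- the factor `2`.
  have hstep : ∀ x h : ℝ≥0, reachProb P R G.source S (x + h) ≤
      reachProb P R G.source S x + 2 * (G.cutRate S).toReal * h := by
    intro x h
    refine (hR.reachProb_add_le hS x h).trans ?_
    have h1 := reachDeriv_le (P := P) (R := R) hS (x : ℝ)
    have h2 : ∑' e : cut S, doubleRate G S h e ≤ (G.cutRate S).toReal := by
      rw [toReal_cutRate]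
      exact (summable_doubleRate hS h.coe_nonneg).tsum_le_tsum (fun e => doubleRate_le S h e.1)
        (summable_rate_cut hS)
    linarith [mul_le_mul_of_nonneg_left h1 h.coe_nonneg,
      mul_le_mul_of_nonneg_left h2 h.coe_nonneg]
  refine (LipschitzWith.of_le_add_mul' (2 * (G.cutRate S).toReal) fun x y => ?_).continuous
  rcases le_total x y with hxy | hxy
  · exact (reachProb_mono _ _ hxy).trans (le_add_of_nonneg_right (by positivity))
  · have := hstep y.toNNReal (x.toNNReal - y.toNNReal)
    rw [← NNReal.coe_add, add_tsub_cancel_of_le (Real.toNNReal_mono hxy)] at this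
    have hnn : ∀ z : ℝ, reachProb P R G.source S z.toNNReal = reachProb P R G.source S z :=
      fun z => by rw [reachProb, reachProb, Real.toNNReal_coe]
    rw [hnn, hnn] at this
    refine this.trans ?_
    gcongr
    rw [Real.dist_eq, abs_of_nonneg (sub_nonneg.2 hxy),
      NNReal.coe_sub (Real.toNNReal_mono hxy), Real.coe_toNNReal', Real.coe_toNNReal']
    rcases le_total 0 y with h | h
    · rw [max_eq_left h, max_eq_left (h.trans hxy)]
    · rw [max_eq_right h]
      rcases le_total 0 x with h' | h'
      · rw [max_eq_left h']
        linarith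
      · rw [max_eq_right h']
        linarith

/-- The slope is squeezed between the two one-step bounds; the double-ring error vanishes by
dominated convergence. Lengthening the window controls right slopes only, which together with
continuity suffices for the fundamental theorem of calculus. -/
lemma IsClocks.hasDerivWithinAt_reachProb [Countable V] [IsProbabilityMeasure P]
    (hR : G.IsClocks R P) {S : Set V}
    (hS : G.cutRate S ≠ ∞) {x : ℝ} (hx : 0 ≤ x) :
    HasDerivWithinAt (reachProb P R G.source S) (reachDeriv G P R S x) (Ioi x) x := by
  lift x to ℝ≥0 using hx
  rw [hasDerivWithinAt_iff_tendsto_slope' self_notMem_Ioi]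
  have hsub : Tendsto (fun y : ℝ => y - (x : ℝ)) (𝓝[>] (x : ℝ)) (𝓝 0) := by
    refine tendsto_nhdsWithin_of_tendsto_nhds ?_
    have : Tendsto (fun y => y - (x : ℝ)) (𝓝 (x : ℝ)) (𝓝 ((x : ℝ) - (x : ℝ))) :=
      (continuous_sub_right (x : ℝ)).tendsto x
    rwa [sub_self] at this
  have hlow : Tendsto (fun y => (1 - (G.cutRate S).toReal * (y - x)) ^ 2 * reachDeriv G P R S x)
      (𝓝[>] (x : ℝ)) (𝓝 (reachDeriv G P R S x)) := by
    have := (((hsub.const_mul (G.cutRate S).toReal).const_sub 1).pow 2).mul_const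
      (reachDeriv G P R S x)
    simpa using this
  have hη : Tendsto (fun y => ∑' e : cut S, doubleRate G S (y - x) e) (𝓝[>] (x : ℝ)) (𝓝 0) := by
    have : Tendsto (fun y => ∑' e : cut S, doubleRate G S (y - x) e) (𝓝[>] (x : ℝ))
        (𝓝 (∑' e : cut S, (0 : ℝ))) := by
      refine tendsto_tsum_of_dominated_convergence (summable_rate_cut hS) (fun e => ?_) ?_
      · have := ((tendsto_const_nhds (x := (1 : ℝ))).min
          (hsub.const_mul (G.cutRate (S ∪ {e.1.1, e.1.2})).toReal)).const_mul
          (G.rate e.1.1 e.1.2 : ℝ)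
        simpa [doubleRate] using this
      · filter_upwards [self_mem_nhdsWithin] with y hy e
        rw [Real.norm_of_nonneg (doubleRate_nonneg S (sub_nonneg.2 (le_of_lt hy)) e.1)]
        exact doubleRate_le S _ e.1
    simpa using this
  have hup : Tendsto (fun y => reachDeriv G P R S x + ∑' e : cut S, doubleRate G S (y - x) e)
      (𝓝[>] (x : ℝ)) (𝓝 (reachDeriv G P R S x)) := by
    simpa using hη.const_add (reachDeriv G P R S x)
  refine tendsto_of_tendsto_of_tendsto_of_le_of_le' hlow hup ?_ ?_
  · have hev : ∀ᶠ y in 𝓝[>] x, (G.cutRate S).toReal * (y - x) < 1 := by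
      have := hsub.const_mul (G.cutRate S).toReal
      rw [mul_zero] at this
      exact this.eventually_lt_const zero_lt_one
    filter_upwards [self_mem_nhdsWithin, hev] with y hy hΛ
    have hy' : 0 < y - x := sub_pos.2 hy
    have := hR.le_reachProb_add hS x (y - x).toNNReal
      (by rw [Real.coe_toNNReal _ hy'.le]; exact hΛ.le)
    rw [slope_def_field, le_div_iff₀ hy']
    rw [Real.coe_toNNReal _ hy'.le, add_sub_cancel] at this
    linarith
  · filter_upwards [self_mem_nhdsWithin] with y hy
    have hy' : 0 < y - x := sub_pos.2 hy
    have := hR.reachProb_add_le hS x (y - x).toNNReal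
    rw [slope_def_field, div_le_iff₀ hy']
    rw [Real.coe_toNNReal _ hy'.le, add_sub_cancel] at this
    linarith

end Probability

/-! ### Mean ages at finite times and in the limit. -/

section MeanAge

variable {G : GossipNetwork V} {Ω : Type*} [MeasurableSpace Ω] {P : Measure Ω}
  {R : V → V → Ω → Set ℝ≥0}

/-- The probability that `S` is not informed within a time window of length `x`. -/
noncomputable def missProb (P : Measure Ω) (R : V → V → Ω → Set ℝ≥0) (n₀ : V) (S : Set V)
    (x : ℝ) : ℝ := 1 - reachProb P R n₀ S x

/-- The mean age of `S` at time `T`. -/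
noncomputable def truncMean (P : Measure Ω) (R : V → V → Ω → Set ℝ≥0) (n₀ : V) (S : Set V)
    (T : ℝ) : ℝ := ∫ x in 0..T, missProb P R n₀ S x

/-- The mean age of `S` in the long run. -/
noncomputable def limitMean (P : Measure Ω) (R : V → V → Ω → Set ℝ≥0) (n₀ : V) (S : Set V) : ℝ :=
  ∫ x in Ioi 0, missProb P R n₀ S x

lemma Informed.eq_source_of_time_zero {ring : V → V → Set ℝ≥0} {n₀ v : V}
    (h : Informed ring n₀ 0 v 0) : v = n₀ := by
  cases h with
  | source => rfl
  | step _ h2 _ h4 => exact absurd (h2.trans_le h4) not_lt_zero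

lemma reachProb_of_nonpos {n₀ : V} {S : Set V} (hn : n₀ ∉ S) {x : ℝ} (hx : x ≤ 0) :
    reachProb P R n₀ S x = 0 := by
  have : informedSet R n₀ S 0 0 = ∅ := by
    refine eq_empty_of_forall_notMem ?_
    rintro ω ⟨v, hv, hi⟩
    exact hn (hi.eq_source_of_time_zero ▸ hv)
  rw [reachProb, Real.toNNReal_of_nonpos hx, this, measureReal_empty]

lemma tendsto_truncMean {n₀ : V} {S : Set V}
    (hi : IntegrableOn (missProb P R n₀ S) (Ioi 0)) :
    Tendsto (truncMean P R n₀ S) atTop (𝓝 (limitMean P R n₀ S)) :=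
  intervalIntegral_tendsto_integral_Ioi 0 hi tendsto_id

section

variable [IsProbabilityMeasure P] {n₀ : V} {S T : Set V}

lemma missProb_nonneg (x : ℝ) : 0 ≤ missProb P R n₀ S x := sub_nonneg.2 (reachProb_le_one _ _ _)

lemma missProb_antitone : Antitone (missProb P R n₀ S) :=
  fun _ _ h => sub_le_sub_left (reachProb_mono _ _ h) _

lemma missProb_le_of_subset (h : S ⊆ T) (x : ℝ) : missProb P R n₀ T x ≤ missProb P R n₀ S x :=
  sub_le_sub_left (reachProb_mono_set _ _ h) _

lemma missProb_of_mem (h : n₀ ∈ S) (x : ℝ) : missProb P R n₀ S x = 0 := by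
  rw [missProb, reachProb_of_mem h, sub_self]

lemma intervalIntegrable_missProb (a b : ℝ) :
    IntervalIntegrable (missProb P R n₀ S) volume a b := missProb_antitone.intervalIntegrable

lemma truncMean_nonneg {t : ℝ} (ht : 0 ≤ t) : 0 ≤ truncMean P R n₀ S t :=
  intervalIntegral.integral_nonneg ht fun x _ => missProb_nonneg x

lemma truncMean_le_of_subset (h : S ⊆ T) {t : ℝ} (ht : 0 ≤ t) :
    truncMean P R n₀ T t ≤ truncMean P R n₀ S t :=
  intervalIntegral.integral_mono_on ht (intervalIntegrable_missProb _ _)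
    (intervalIntegrable_missProb _ _) fun x _ => missProb_le_of_subset h x

lemma truncMean_of_mem (h : n₀ ∈ S) (t : ℝ) : truncMean P R n₀ S t = 0 := by
  simp [truncMean, missProb_of_mem h]

lemma limitMean_of_mem (h : n₀ ∈ S) : limitMean P R n₀ S = 0 := by
  simp [limitMean, missProb_of_mem h]

lemma integrableOn_missProb {C : ℝ} (hC : ∀ t, 0 ≤ t → truncMean P R n₀ S t ≤ C) :
    IntegrableOn (missProb P R n₀ S) (Ioi 0) := by
  refine integrableOn_Ioi_of_intervalIntegral_norm_bounded C 0 (b := fun t : ℝ => t) (l := atTop)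
    (fun t => ?_) tendsto_id ?_
  · exact (intervalIntegrable_missProb 0 t).1
  · filter_upwards [eventually_ge_atTop 0] with t ht
    simp only [Real.norm_of_nonneg (missProb_nonneg _)]
    exact hC t ht

lemma truncMean_le_limitMean (hi : IntegrableOn (missProb P R n₀ S) (Ioi 0)) {t : ℝ}
    (ht : 0 ≤ t) : truncMean P R n₀ S t ≤ limitMean P R n₀ S := by
  rw [truncMean, intervalIntegral.integral_of_le ht]
  exact setIntegral_mono_set hi (Eventually.of_forall fun x => missProb_nonneg x)
    (Eventually.of_forall fun x hx => hx.1)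

lemma limitMean_le_of_subset (h : S ⊆ T) (hi : IntegrableOn (missProb P R n₀ S) (Ioi 0)) :
    limitMean P R n₀ T ≤ limitMean P R n₀ S :=
  setIntegral_mono_on (hi.mono' missProb_antitone.measurable.aestronglyMeasurable
    (Eventually.of_forall fun x => by
      rw [Real.norm_of_nonneg (missProb_nonneg x)]
      exact missProb_le_of_subset h x)) hi measurableSet_Ioi fun x _ => missProb_le_of_subset h x

lemma mul_missProb_le_truncMean {t : ℝ} (ht : 0 ≤ t) :
    t * missProb P R n₀ S t ≤ truncMean P R n₀ S t := by
  have : ∫ _ in (0 : ℝ)..t, missProb P R n₀ S t = t * missProb P R n₀ S t := by simp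
  rw [← this]
  exact intervalIntegral.integral_mono_on ht intervalIntegrable_const
    (intervalIntegrable_missProb _ _) fun x hx => missProb_antitone hx.2

/-- For an antitone function, `t` times its value at `t` is at most its integral up to `t`, which
stays bounded. -/
lemma tendsto_missProb (hi : IntegrableOn (missProb P R n₀ S) (Ioi 0)) :
    Tendsto (missProb P R n₀ S) atTop (𝓝 0) := by
  refine squeeze_zero' (Eventually.of_forall missProb_nonneg) ?_
    ((tendsto_const_nhds (x := limitMean P R n₀ S)).div_atTop tendsto_id)
  filter_upwards [eventually_gt_atTop 0] with t ht
  rw [id, le_div_iff₀ ht, mul_comm]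
  exact (mul_missProb_le_truncMean ht.le).trans (truncMean_le_limitMean hi ht.le)

end

section

variable [Countable V] [IsProbabilityMeasure P] {S : Set V}

/-- The formula for the derivative is integrated term by term over `[0, t]`, with the summable rates
as dominating constants. -/
lemma IsClocks.hasSum_truncMean (hR : G.IsClocks R P) (hS : G.cutRate S ≠ ∞) {t : ℝ}
    (ht : 0 ≤ t) :
    HasSum (fun e : cut S => G.rate e.1.1 e.1.2 *
        (truncMean P R G.source S t - truncMean P R G.source (S ∪ {e.1.1, e.1.2}) t))
      (reachProb P R G.source S t - reachProb P R G.source S 0) := by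
  have hgap : ∀ (e : V × V) (x : ℝ), reachGap G P R S x e = G.rate e.1 e.2 *
      (missProb P R G.source S x - missProb P R G.source (S ∪ {e.1, e.2}) x) := by
    intro e x
    simp only [reachGap, missProb]
    ring
  have hmeas : ∀ e : V × V, Measurable fun x => reachGap G P R S x e := by
    intro e
    simp only [hgap]
    exact (missProb_antitone.measurable.sub missProb_antitone.measurable).const_mul _
  have hsum : HasSum (fun e : cut S => ∫ x in 0..t, reachGap G P R S x e)
      (∫ x in 0..t, reachDeriv G P R S x) := by
    refine intervalIntegral.hasSum_integral_of_dominated_convergence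
      (fun (e : cut S) (_ : ℝ) => (G.rate e.1.1 e.1.2 : ℝ))
      (fun e => (hmeas e).aestronglyMeasurable) (fun e => Eventually.of_forall fun x _ => ?_)
      (Eventually.of_forall fun x _ => summable_rate_cut hS) intervalIntegrable_const
      (Eventually.of_forall fun x _ => (summable_reachGap hS x).hasSum)
    rw [Real.norm_of_nonneg (reachGap_nonneg _ _ _)]
    exact reachGap_le _ _ _
  have hint : IntervalIntegrable (reachDeriv G P R S) volume 0 t := by
    have hm : Measurable (reachDeriv G P R S) := by
      -- In `ℝ≥0∞` a countable sum of measurable functions is measurable without any summability.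
      have : (reachDeriv G P R S) = fun x =>
          (∑' e : cut S, ENNReal.ofReal (reachGap G P R S x e)).toReal := by
        funext x
        rw [← ENNReal.ofReal_tsum_of_nonneg (f := fun e : cut S => reachGap G P R S x e)
          (fun e => reachGap_nonneg S _ e.1) (summable_reachGap hS _)]
        exact (ENNReal.toReal_ofReal (reachDeriv_nonneg S x)).symm
      rw [this]
      exact (Measurable.tsum fun e : cut S => (hmeas e).ennreal_ofReal).ennreal_toReal
    refine (intervalIntegrable_const (c := (G.cutRate S).toReal)).mono_fun hm.aestronglyMeasurable
      (Eventually.of_forall fun x => ?_)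
    beta_reduce
    rw [Real.norm_of_nonneg (reachDeriv_nonneg _ _), Real.norm_of_nonneg ENNReal.toReal_nonneg]
    exact reachDeriv_le hS x
  rw [intervalIntegral.integral_eq_sub_of_hasDeriv_right_of_le ht
    (hR.continuous_reachProb hS).continuousOn
    (fun x hx => hR.hasDerivWithinAt_reachProb hS hx.1.le) hint] at hsum
  refine hsum.congr_fun ?_
  intro e
  simp only [hgap, truncMean]
  rw [intervalIntegral.integral_const_mul, intervalIntegral.integral_sub
    (intervalIntegrable_missProb _ _) (intervalIntegrable_missProb _ _)]

/-- Induction along the path. All terms of `hasSum_truncMean` are nonnegative and their sum is at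
most `1`, so the term of `(a, b)` alone gives `M_S ≤ 1/λ_{ab} + M_{S ∪ {a, b}}`. The claim ranges
over all sets containing the node because the set grows at each step. -/
lemma IsClocks.exists_truncMean_le (hR : G.IsClocks R P) {v : V}
    (hv : Relation.ReflTransGen (fun a b => G.rate a b ≠ 0) G.source v) :
    ∀ S : Set V, v ∈ S → G.cutRate S ≠ ∞ →
      ∃ C, ∀ t, 0 ≤ t → truncMean P R G.source S t ≤ C := by
  induction hv with
  | refl => exact fun S hS _ => ⟨0, fun t _ => (truncMean_of_mem hS t).le⟩
  | @tail a b _ hab ih =>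
    intro S hb hS
    by_cases ha : a ∈ S
    · exact ih S ha hS
    have he : (a, b) ∈ cut S := ⟨ha, hb⟩
    obtain ⟨C, hC⟩ := ih (S ∪ {a, b}) (Or.inr (Or.inl rfl)) (cutRate_union_ne_top hS he)
    refine ⟨1 / G.rate a b + C, fun t ht => ?_⟩
    have hsum := hR.hasSum_truncMean hS ht
    have hpos : (0 : ℝ) < G.rate a b := by
      exact_mod_cast pos_iff_ne_zero.2 hab
    have h1 := le_hasSum hsum ⟨(a, b), he⟩ fun e _ => mul_nonneg NNReal.zero_le_coe
      (sub_nonneg.2 (truncMean_le_of_subset subset_union_left ht))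
    have h2 : reachProb P R G.source S t - reachProb P R G.source S 0 ≤ 1 := by
      linarith [reachProb_le_one (P := P) (R := R) G.source S t,
        reachProb_nonneg (P := P) (R := R) G.source S 0]
    have h3 := (le_div_iff₀' hpos).2 (h1.trans h2)
    linarith [hC t ht]

lemma IsClocks.integrableOn_missProb (hR : G.IsClocks R P) (hS : G.cutRate S ≠ ∞)
    (hr : G.Reachable S) : IntegrableOn (missProb P R G.source S) (Ioi 0) := by
  obtain ⟨v, hv, hp⟩ := hr
  obtain ⟨C, hC⟩ := hR.exists_truncMean_le hp S hv hS
  exact GossipNetwork.integrableOn_missProb hC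

/-- The recursion for the long-run mean ages. -/
lemma IsClocks.hasSum_limitMean (hR : G.IsClocks R P) (hS : G.cutRate S ≠ ∞)
    (hr : G.Reachable S) (hn : G.source ∉ S) :
    HasSum (fun e : cut S => G.rate e.1.1 e.1.2 *
      (limitMean P R G.source S - limitMean P R G.source (S ∪ {e.1.1, e.1.2}))) 1 := by
  have hi := hR.integrableOn_missProb hS hr
  have hr' : ∀ e : cut S, G.Reachable (S ∪ {e.1.1, e.1.2}) := fun e =>
    let ⟨v, hv, hp⟩ := hr
    ⟨v, Or.inl hv, hp⟩
  have hi' : ∀ e : cut S, IntegrableOn (missProb P R G.source (S ∪ {e.1.1, e.1.2})) (Ioi 0) :=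
    fun e => hR.integrableOn_missProb (cutRate_union_ne_top hS e.2) (hr' e)
  have hlim : Tendsto (fun t => ∑' e : cut S, G.rate e.1.1 e.1.2 *
        (truncMean P R G.source S t - truncMean P R G.source (S ∪ {e.1.1, e.1.2}) t)) atTop
      (𝓝 (∑' e : cut S, G.rate e.1.1 e.1.2 *
        (limitMean P R G.source S - limitMean P R G.source (S ∪ {e.1.1, e.1.2})))) := by
    refine tendsto_tsum_of_dominated_convergence
      ((summable_rate_cut hS).mul_right (limitMean P R G.source S)) (fun e =>
        ((tendsto_truncMean hi).sub (tendsto_truncMean (hi' e))).const_mul _) ?_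
    filter_upwards [eventually_ge_atTop 0] with t ht e
    rw [Real.norm_of_nonneg (mul_nonneg NNReal.zero_le_coe
      (sub_nonneg.2 (truncMean_le_of_subset subset_union_left ht)))]
    gcongr
    linarith [truncMean_le_limitMean hi ht,
      truncMean_nonneg (P := P) (R := R) (n₀ := G.source) (S := S ∪ {e.1.1, e.1.2}) ht]
  -- The same sum equals `F_S(t) - F_S(0)`, where `F_S(0) = 0` because the source lies outside `S`.
  have hlim' : Tendsto (fun t => ∑' e : cut S, G.rate e.1.1 e.1.2 *
      (truncMean P R G.source S t - truncMean P R G.source (S ∪ {e.1.1, e.1.2}) t)) atTop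
      (𝓝 1) := by
    have : Tendsto (fun t => 1 - missProb P R G.source S t) atTop (𝓝 (1 - 0)) :=
      (tendsto_missProb hi).const_sub 1
    rw [sub_zero] at this
    refine this.congr' ?_
    filter_upwards [eventually_ge_atTop 0] with t ht
    rw [(hR.hasSum_truncMean hS ht).tsum_eq, reachProb_of_nonpos hn le_rfl, missProb]
    ring
  rw [← tendsto_nhds_unique hlim hlim']
  refine Summable.hasSum (Summable.of_nonneg_of_le (fun e => mul_nonneg NNReal.zero_le_coe
    (sub_nonneg.2 (limitMean_le_of_subset subset_union_left hi))) (fun e => ?_)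
    ((summable_rate_cut hS).mul_right (limitMean P R G.source S)))
  gcongr
  linarith [setIntegral_nonneg (μ := volume) measurableSet_Ioi fun x (_ : x ∈ Ioi (0 : ℝ)) =>
    missProb_nonneg (P := P) (R := R) (n₀ := G.source) (S := S ∪ {e.1.1, e.1.2}) x,
    show limitMean P R G.source (S ∪ {e.1.1, e.1.2}) = ∫ x in Ioi (0 : ℝ),
      missProb P R G.source (S ∪ {e.1.1, e.1.2}) x from rfl]

end

end MeanAge

/-! ### The law of the age. -/

section Law

variable {G : GossipNetwork V} {S : Set V}

/-- `cut S` consists of `inBoundary S`, the pairs from the source, and pairs of rate `0`, on which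
`f` vanishes. -/
lemma hasSum_cut {f : V × V → ℝ} (hf : ∀ e : V × V, G.rate e.1 e.2 = 0 → f e = 0)
    (hn : G.source ∉ S) {a b : ℝ} (ha : HasSum (fun e : G.inBoundary S => f e) a)
    (hb : HasSum (fun v : S => f (G.source, v)) b) : HasSum (fun e : cut S => f e) (a + b) := by
  have ha' : HasSum ((G.inBoundary S).indicator f) a := hasSum_subtype_iff_indicator.1 ha
  have hb' : HasSum (S.indicator fun v => f (G.source, v)) b :=
    (hasSum_subtype_iff_indicator (f := fun v => f (G.source, v))).1 hb
  have hinj : Function.Injective fun v : V => (G.source, v) := fun _ _ h => (Prod.ext_iff.1 h).2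
  have hcomp : {e : V × V | e.1 = G.source ∧ e.2 ∈ S}.indicator f ∘ (fun v : V => (G.source, v)) =
      S.indicator fun v => f (G.source, v) := by
    funext v
    by_cases hv : v ∈ S <;> simp [hv]
  rw [← hcomp, hinj.hasSum_iff] at hb'
  · refine hasSum_subtype_iff_indicator.2 ((ha'.add hb').congr_fun fun e => ?_)
    classical
    simp only [indicator_apply]
    by_cases h0 : G.rate e.1 e.2 = 0
    · simp [hf e h0]
    · by_cases h2 : e.2 ∈ S
      · by_cases h1 : e.1 = G.source
        · simp [cut, inBoundary, h1, h2, hn]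
        · by_cases h3 : e.1 ∈ S <;> simp [cut, inBoundary, h0, h1, h2, h3]
      · simp [cut, inBoundary, h2]
  · rintro e he
    refine indicator_of_notMem (fun h => he ⟨e.2, ?_⟩) _
    rw [← h.1]

lemma FiniteRate.hasSum_cut (h : G.FiniteRate S) (hn : G.source ∉ S) :
    HasSum (fun e : cut S => (G.rate e.1.1 e.1.2 : ℝ))
      ((∑' e : G.inBoundary S, (G.rate e.1.1 e.1.2 : ℝ)) + G.sourceRate S) :=
  GossipNetwork.hasSum_cut (f := fun e => (G.rate e.1 e.2 : ℝ))
    (fun e he => by simp [he]) hn h.2.hasSum h.1.hasSum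

lemma FiniteRate.cutRate_ne_top (h : G.FiniteRate S) (hn : G.source ∉ S) : G.cutRate S ≠ ∞ :=
  ENNReal.tsum_coe_ne_top_iff_summable.2 (NNReal.summable_coe.1 (h.hasSum_cut hn).summable)

variable {Ω : Type*} [MeasurableSpace Ω] {P : Measure Ω}
  {R : V → V → Ω → Set ℝ≥0}

lemma tendsto_reachProb_atBot {n₀ : V} (hn : n₀ ∉ S) : Tendsto (reachProb P R n₀ S) atBot (𝓝 0) :=
  tendsto_const_nhds.congr' <| by
    filter_upwards [eventually_le_atBot 0] with x hx
    exact (reachProb_of_nonpos hn hx).symm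

variable [IsProbabilityMeasure P]

/-- The law of the age of `S` in the long run: its distribution function is `reachProb`. -/
noncomputable def ageLaw (P : Measure Ω) [IsProbabilityMeasure P] (R : V → V → Ω → Set ℝ≥0)
    (n₀ : V) (S : Set V) : Measure ℝ :=
  (reachProb_mono (P := P) (R := R) n₀ S).stieltjesFunction.measure

section AgeLaw

variable {n₀ : V}

lemma coe_stieltjesFunction_reachProb (hc : Continuous (reachProb P R n₀ S)) :
    ⇑(reachProb_mono (P := P) (R := R) n₀ S).stieltjesFunction = reachProb P R n₀ S :=
  funext fun _ => hc.continuousWithinAt.rightLim_eq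

lemma tendsto_reachProb_atTop (hi : IntegrableOn (missProb P R n₀ S) (Ioi 0)) :
    Tendsto (reachProb P R n₀ S) atTop (𝓝 1) := by
  simpa [missProb] using (tendsto_missProb hi).const_sub 1

lemma isProbabilityMeasure_ageLaw (hc : Continuous (reachProb P R n₀ S)) (hn : n₀ ∉ S)
    (hi : IntegrableOn (missProb P R n₀ S) (Ioi 0)) : IsProbabilityMeasure (ageLaw P R n₀ S) := by
  refine StieltjesFunction.isProbabilityMeasure _ ?_ ?_
  · rw [coe_stieltjesFunction_reachProb hc]
    exact tendsto_reachProb_atBot hn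
  · rw [coe_stieltjesFunction_reachProb hc]
    exact tendsto_reachProb_atTop hi

lemma ageLaw_Iic (hc : Continuous (reachProb P R n₀ S)) (hn : n₀ ∉ S) (x : ℝ) :
    ageLaw P R n₀ S (Iic x) = ENNReal.ofReal (reachProb P R n₀ S x) := by
  rw [ageLaw, StieltjesFunction.measure_Iic _ (l := 0), coe_stieltjesFunction_reachProb hc, sub_zero]
  rw [coe_stieltjesFunction_reachProb hc]
  exact tendsto_reachProb_atBot hn

lemma ageLaw_Ici (hc : Continuous (reachProb P R n₀ S))
    (hi : IntegrableOn (missProb P R n₀ S) (Ioi 0)) (x : ℝ) :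
    ageLaw P R n₀ S (Ici x) = ENNReal.ofReal (missProb P R n₀ S x) := by
  rw [ageLaw, StieltjesFunction.measure_Ici _ (l := 1), coe_stieltjesFunction_reachProb hc,
    hc.continuousWithinAt.leftLim_eq, missProb]
  rw [coe_stieltjesFunction_reachProb hc]
  exact tendsto_reachProb_atTop hi

lemma ae_nonneg_ageLaw (hc : Continuous (reachProb P R n₀ S)) (hn : n₀ ∉ S) :
    ∀ᵐ x ∂(ageLaw P R n₀ S), 0 ≤ x := by
  rw [ae_iff]
  refine measure_mono_null (t := Iic 0) (fun x hx => le_of_not_ge hx) ?_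
  rw [ageLaw_Iic hc hn, reachProb_of_nonpos hn le_rfl, ENNReal.ofReal_zero]

lemma integrable_ageLaw (hc : Continuous (reachProb P R n₀ S)) (hn : n₀ ∉ S)
    (hi : IntegrableOn (missProb P R n₀ S) (Ioi 0)) :
    Integrable (fun x : ℝ => x) (ageLaw P R n₀ S) := by
  refine ⟨measurable_id.aestronglyMeasurable, ?_⟩
  rw [hasFiniteIntegral_iff_ofReal (ae_nonneg_ageLaw hc hn),
    lintegral_eq_lintegral_meas_le _ (ae_nonneg_ageLaw hc hn) measurable_id.aemeasurable]
  have : ∀ x, ageLaw P R n₀ S {a | x ≤ a} = ENNReal.ofReal (missProb P R n₀ S x) := ageLaw_Ici hc hi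
  simp only [this]
  exact (hasFiniteIntegral_iff_ofReal (Eventually.of_forall fun x => missProb_nonneg x)).1 hi.2

lemma integral_ageLaw (hc : Continuous (reachProb P R n₀ S)) (hn : n₀ ∉ S)
    (hi : IntegrableOn (missProb P R n₀ S) (Ioi 0)) :
    ∫ x, x ∂(ageLaw P R n₀ S) = limitMean P R n₀ S := by
  rw [(integrable_ageLaw hc hn hi).integral_eq_integral_meas_le (ae_nonneg_ageLaw hc hn), limitMean]
  refine setIntegral_congr_fun measurableSet_Ioi fun x _ => ?_
  have : ageLaw P R n₀ S {a | x ≤ a} = ENNReal.ofReal (missProb P R n₀ S x) := ageLaw_Ici hc hi x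
  simp only [measureReal_def, this, ENNReal.toReal_ofReal (missProb_nonneg x)]

end AgeLaw

section Age

variable [Countable V]

lemma IsClocks.measure_age_latest_lt (hR : G.IsClocks R P) (hS : S.Nonempty) (hn : G.source ∉ S)
    {t : ℝ≥0} {x : ℝ} (hx : 0 ≤ x) (hxt : x ≤ t) :
    MeasurableSet {ω | age (fun v t => (latest (fun u v => R u v ω) G.source v t : ℝ)) S t < x} ∧
    P {ω | age (fun v t => (latest (fun u v => R u v ω) G.source v t : ℝ)) S t < x} =
      ENNReal.ofReal (reachProb P R G.source S x) := by
  lift x to ℝ≥0 using hx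
  obtain ⟨s, rfl⟩ : ∃ s, t = s + x := ⟨t - x, (tsub_add_cancel_of_le (by exact_mod_cast hxt)).symm⟩
  have : {ω | age (fun v t => (latest (fun u v => R u v ω) G.source v t : ℝ)) S (s + x) < x} =
      informedSet R G.source S s (s + x) := by
    ext ω
    exact age_latest_lt_iff hS hn s x
  rw [this, ofReal_reachProb]
  exact ⟨hR.measurableSet_informedSet S s x, hR.measure_informedSet S s x⟩

lemma IsClocks.measurable_age_latest (hR : G.IsClocks R P) (hS : S.Nonempty) (hn : G.source ∉ S)
    (t : ℝ≥0) :
    Measurable fun ω => age (fun v t => (latest (fun u v => R u v ω) G.source v t : ℝ)) S t := by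
  refine measurable_of_Iio fun x => ?_
  rcases lt_or_ge x 0 with hx | hx
  · convert MeasurableSet.empty
    exact eq_empty_of_forall_notMem fun ω hω =>
      absurd (age_latest_nonneg S t) (not_le.2 (lt_trans hω hx))
  rcases le_or_gt x t with hxt | hxt
  · exact (hR.measure_age_latest_lt hS hn hx hxt).1
  · convert MeasurableSet.univ
    exact eq_univ_of_forall fun ω => (age_latest_le t).trans_lt hxt

lemma IsClocks.integrable_age_latest (hR : G.IsClocks R P) (hS : S.Nonempty) (hn : G.source ∉ S)
    (t : ℝ≥0) :
    Integrable (fun ω => age (fun v t => (latest (fun u v => R u v ω) G.source v t : ℝ)) S t) P :=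
  Integrable.of_mem_Icc 0 t (hR.measurable_age_latest hS hn t).aemeasurable
    (Eventually.of_forall fun _ => ⟨age_latest_nonneg S t, age_latest_le t⟩)

/-- Strict events have been computed exactly; continuity of `reachProb` passes to `≤` through levels
`y` in `(x, t]`, so room above `x` is needed. At `x = t` the formula can fail, as the age never
exceeds `t`. -/
lemma IsClocks.measure_age_latest_le (hR : G.IsClocks R P) (hS : S.Nonempty) (hn : G.source ∉ S)
    (hc : Continuous (reachProb P R G.source S)) {t : ℝ≥0} {x : ℝ} (hxt : x < t) :
    P {ω | age (fun v t => (latest (fun u v => R u v ω) G.source v t : ℝ)) S t ≤ x} =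
      ENNReal.ofReal (reachProb P R G.source S x) := by
  rcases lt_or_ge x 0 with hx | hx
  · rw [reachProb_of_nonpos hn hx.le, ENNReal.ofReal_zero]
    convert measure_empty (μ := P)
    exact eq_empty_of_forall_notMem fun ω hω =>
      absurd (age_latest_nonneg S t) (not_le.2 (lt_of_le_of_lt hω hx))
  refine le_antisymm ?_ ?_
  · have : Tendsto (fun y => ENNReal.ofReal (reachProb P R G.source S y)) (𝓝[>] x)
        (𝓝 (ENNReal.ofReal (reachProb P R G.source S x))) :=
      ENNReal.tendsto_ofReal ((hc.tendsto x).mono_left nhdsWithin_le_nhds)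
    refine ge_of_tendsto this ?_
    filter_upwards [Ioo_mem_nhdsGT hxt] with y hy
    rw [← (hR.measure_age_latest_lt hS hn (hx.trans hy.1.le) hy.2.le).2]
    exact measure_mono fun ω hω => lt_of_le_of_lt hω hy.1
  · rw [← (hR.measure_age_latest_lt hS hn hx hxt.le).2]
    refine measure_mono fun ω hω => ?_
    rw [mem_ofPred_eq] at hω ⊢
    exact hω.le

/-- Layer-cake formula on `[0, t]`, the range of the age at time `t`. -/
lemma IsClocks.integral_age_latest (hR : G.IsClocks R P) (hS : S.Nonempty) (hn : G.source ∉ S)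
    (t : ℝ≥0) :
    ∫ ω, age (fun v t => (latest (fun u v => R u v ω) G.source v t : ℝ)) S t ∂P =
      truncMean P R G.source S t := by
  rw [(hR.integrable_age_latest hS hn t).integral_eq_integral_Ioc_meas_le (M := t)
    (Eventually.of_forall fun _ => age_latest_nonneg S t)
    (Eventually.of_forall fun _ => age_latest_le t), truncMean,
    intervalIntegral.integral_of_le t.coe_nonneg]
  refine setIntegral_congr_fun measurableSet_Ioc fun x hx => ?_
  obtain ⟨hm, hP⟩ := hR.measure_age_latest_lt hS hn hx.1.le hx.2
  have : {ω | x ≤ age (fun v t => (latest (fun u v => R u v ω) G.source v t : ℝ)) S t} =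
      {ω | age (fun v t => (latest (fun u v => R u v ω) G.source v t : ℝ)) S t < x}ᶜ := by
    ext ω
    simp
  simp only [this, probReal_compl_eq_one_sub hm, missProb]
  rw [measureReal_def, hP, ENNReal.toReal_ofReal (reachProb_nonneg _ _ _)]

end Age

end Law

end GossipNetwork

/-! ### The theorem. -/

open GossipNetwork in
theorem theorem1 {V : Type*} [Countable V] (G : GossipNetwork V)
    {Ω : Type*} [MeasurableSpace Ω] (P : Measure Ω) [IsProbabilityMeasure P]
    (R : V → V → Ω → Set ℝ≥0) (hR : G.IsClocks R P)
    (N : Ω → V → ℝ≥0 → ℝ) (hN : ∀ᵐ ω ∂P, G.IsTimestamps (fun u v => R u v ω) (N ω)) :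
    ∃ X : Set V → Measure ℝ, ∀ S : Set V,
      G.source ∉ S → G.FiniteRate S → G.Reachable S →
        -- `X S` is the time-invariant law of the age of `S`
        IsProbabilityMeasure (X S) ∧
        (∀ (t : ℝ≥0) (x : ℝ), x < t → P {ω | GossipNetwork.age (N ω) S t ≤ x} = X S (Iic x)) ∧
        -- its mean is finite and is the long-term expected age
        Integrable (fun x : ℝ => x) (X S) ∧
        (∀ t : ℝ≥0, Integrable (fun ω => GossipNetwork.age (N ω) S t) P) ∧
        Tendsto (fun t : ℝ≥0 => ∫ ω, GossipNetwork.age (N ω) S t ∂P) atTop (𝓝 (∫ x, x ∂(X S))) ∧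
        -- the recursion
        (Summable fun e : G.inBoundary S =>
          (G.rate e.1.1 e.1.2 : ℝ) * ∫ x, x ∂(X (S ∪ {e.1.1, e.1.2}))) ∧
        0 < G.sourceRate S + ∑' e : G.inBoundary S, (G.rate e.1.1 e.1.2 : ℝ) ∧
        ∫ x, x ∂(X S) =
          (1 + ∑' e : G.inBoundary S,
            (G.rate e.1.1 e.1.2 : ℝ) * ∫ x, x ∂(X (S ∪ {e.1.1, e.1.2}))) /
          (G.sourceRate S + ∑' e : G.inBoundary S, (G.rate e.1.1 e.1.2 : ℝ)) := by
  refine ⟨ageLaw P R G.source, fun S hn hf hr => ?_⟩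
  have hS := hf.cutRate_ne_top hn
  have hc := hR.continuous_reachProb hS
  have hi := hR.integrableOn_missProb hS hr
  have hne : S.Nonempty := let ⟨v, hv, _⟩ := hr; ⟨v, hv⟩
  have hage : ∀ t : ℝ≥0, (fun ω => age (N ω) S t) =ᵐ[P]
      fun ω => age (fun v t => (latest (fun u v => R u v ω) G.source v t : ℝ)) S t := by
    intro t
    filter_upwards [hN, hR.ae_isRegular] with ω hω hreg
    rw [hreg.eq_latest hω]
  have hmean : ∀ e : G.inBoundary S, ∫ x, x ∂(ageLaw P R G.source (S ∪ {e.1.1, e.1.2})) =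
      limitMean P R G.source (S ∪ {e.1.1, e.1.2}) := by
    rintro ⟨e, -, h1, h2, h3⟩
    have hS' := cutRate_union_ne_top hS (e := e) ⟨h1, h2⟩
    refine integral_ageLaw (hR.continuous_reachProb hS') ?_ (hR.integrableOn_missProb hS' ?_)
    · rintro (h | h | h)
      · exact hn h
      · exact h3 h.symm
      · exact hn (mem_singleton_iff.1 h ▸ h2)
    · obtain ⟨v, hv, hp⟩ := hr
      exact ⟨v, Or.inl hv, hp⟩
  have hM := integral_ageLaw hc hn hi
  have hM0 : ∀ T, 0 ≤ limitMean P R G.source T := fun T =>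
    setIntegral_nonneg measurableSet_Ioi fun x _ => missProb_nonneg x
  have hsumm : Summable fun e : G.inBoundary S =>
      (G.rate e.1.1 e.1.2 : ℝ) * limitMean P R G.source (S ∪ {e.1.1, e.1.2}) :=
    Summable.of_nonneg_of_le (fun e => mul_nonneg NNReal.zero_le_coe (hM0 _))
      (fun e => mul_le_mul_of_nonneg_left (limitMean_le_of_subset subset_union_left hi)
        NNReal.zero_le_coe) (hf.2.mul_right (limitMean P R G.source S))
  have hrec : (G.sourceRate S + ∑' e : G.inBoundary S, (G.rate e.1.1 e.1.2 : ℝ)) *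
      limitMean P R G.source S = 1 + ∑' e : G.inBoundary S,
        (G.rate e.1.1 e.1.2 : ℝ) * limitMean P R G.source (S ∪ {e.1.1, e.1.2}) := by
    -- Source edges contribute `b = 0`: a set containing the source has mean age `0`. So the sum
    -- over the whole cut reduces to the sum over `inBoundary S`.
    have h1 := GossipNetwork.hasSum_cut (G := G)
      (f := fun e => (G.rate e.1 e.2 : ℝ) * limitMean P R G.source (S ∪ {e.1, e.2}))
      (fun e he => by simp [he]) hn hsumm.hasSum (b := 0) <| by
        refine hasSum_zero.congr_fun fun v => ?_
        rw [limitMean_of_mem (S := S ∪ {G.source, v.1}) (by simp), mul_zero]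
    have h2 := (hR.hasSum_limitMean hS hr hn).add h1
    have h3 := (hf.hasSum_cut hn).mul_right (limitMean P R G.source S)
    have h4 := h3.unique (h2.congr_fun fun e => by ring)
    linarith
  have hsum0 : 0 ≤ ∑' e : G.inBoundary S,
      (G.rate e.1.1 e.1.2 : ℝ) * limitMean P R G.source (S ∪ {e.1.1, e.1.2}) :=
    tsum_nonneg fun e => mul_nonneg NNReal.zero_le_coe (hM0 _)
  -- Positivity of the total rate is read off the recursion: its product with a nonnegative mean is
  -- at least `1`.
  have hpos : 0 < G.sourceRate S + ∑' e : G.inBoundary S, (G.rate e.1.1 e.1.2 : ℝ) :=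
    pos_of_mul_pos_left (b := limitMean P R G.source S) (by rw [hrec]; linarith) (hM0 S)
  simp only [hmean, hM]
  refine ⟨isProbabilityMeasure_ageLaw hc hn hi, fun t x hxt => ?_, integrable_ageLaw hc hn hi,
    fun t => (hR.integrable_age_latest hne hn t).congr (hage t).symm, ?_, hsumm, hpos, ?_⟩
  · rw [ageLaw_Iic hc hn, ← hR.measure_age_latest_le hne hn hc hxt]
    refine measure_congr ?_
    filter_upwards [hage t] with ω hω
    exact congrArg (· ≤ x) hω
  · refine ((tendsto_truncMean hi).comp (NNReal.tendsto_coe_atTop.2 tendsto_id)).congr fun t => ?_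
    rw [integral_congr_ae (hage t), hR.integral_age_latest hne hn]
    rfl
  · rw [eq_div_iff hpos.ne', mul_comm, hrec]
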